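/- **Setting.** Let $d\in\mathbb N$, $\Theta\subset\mathbb R^d$, let $\mathcal A$ be a set of actions with a feature map $\phi:\mathcal A\to\mathbb R^d$, let $g:\mathbb R\to\mathbb R$ be strictly increasing and continuously differentiable, and let $f_\rho(a)=g(\langle\phi(a),\rho\rangle)$. The true parameter $\theta$ is a random variable with values in $\Theta$ (its law, the prior, is arbitrary). In each period $t=1,2,\dots$ an agent who knows the history $H_t=(A_1,R_1,\dots,A_{t-1},R_{t-1})$ samples an action $A_t$ from a distribution $\pi_t(H_t)$ on $\mathcal A$ (independently of $\theta$ given $H_t$; all actions are available in every period) and observes a reward $R_t$ with $\mathbb E[R_t\mid H_t,\theta,A_t]=f_\theta(A_t)$. Let $A_t^*$ be a random variable with $A_t^*\in\arg\max_{a\in\mathcal A}f_\theta(a)$ almost surely. (All functions involved are assumed measurable.) For actions $a_1,\dots,a_d\in\mathcal A$, posterior sampling with initial design, $\pi^{\rm IPS}_{a_1,\dots,a_d}$, plays $A_t=a_t$ for $t\le d$ and uses $\pi_t(H_t)=\mathbb P(A_t^*\in\cdot\mid H_t)$ for $t>d$. Its Bayesian regret is $$\mathrm{BayesRegret}(T,\pi^{\rm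 IPS}_{a_1,\dots,a_d})=\sum_{t=1}^T\mathbb E\Big[\max_{a\in\mathcal A}f_\theta(a)-f_\theta(A_t)\Big].$$ **Proposition.** Fix positive constants $c_1,c_2,C,\lambda$. There is a constant $K>0$ that depends only on $c_1,c_2,C,\lambda$ such that the following holds for every $d$ and every setting as above. Suppose that $\sup_{\rho\in\Theta}\|\rho\|_2\le c_1$, $\sup_{a\in\mathcal A}\|\phi(a)\|_2\le c_2$, $\sum_{i=1}^d\phi(a_i)\phi(a_i)^{T}\succeq\lambda I$, and $R_t\in[0,C]$ almost surely for all $t$, and let $$r=\frac{\sup_{\rho\in\operatorname{conv}\Theta,\,a\in\mathcal A}g'(\langle\phi(a),\rho\rangle)}{\inf_{\rho\in\operatorname{conv}\Theta,\,a\in\mathcal A}g'(\langle\phi(a),\rho\rangle)},$$ where $\operatorname{conv}\Theta$ is the convex hull of $\Theta$ (equal to $\Theta$ if $\Theta$ is convex) and the infimum in the denominator is assumed to be positive. Then the expectations that define the Bayesian regret are finite and, for all integers $T\ge 2$, $$\mathrm{BayesRegret}(T,\pi^{\rm IPS}_{a_1,\dots,a_d})\le K\,r\,d\,(\log T)^{3/2}\sqrt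 T .$$ -/

import Mathlib

open MeasureTheory ProbabilityTheory

noncomputable section

/-- The history available before choosing the action of period `t` (periods are numbered from `0`):
the actions and rewards of the periods `0, …, t - 1`. The action set is the same in all periods,
so that it carries no information and is not recorded. -/
def history {Ω 𝒜 : Type*} (A : ℕ → Ω → 𝒜) (R : ℕ → Ω → ℝ) (t : ℕ) (ω : Ω) : Fin t → 𝒜 × ℝ :=
  fun k => (A k ω, R k ω)

/-- A policy maps each history to a probability distribution over the actions. -/
structure Policy (𝒜 : Type*) [MeasurableSpace 𝒜] where
  kernel : (t : ℕ) → Kernel (Fin t → 𝒜 × ℝ) 𝒜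
  isMarkov : ∀ t, IsMarkovKernel (kernel t)

/-- `A` and `R` are the actions and rewards produced by the policy `π` in the bandit problem with
mean reward functions `f` and random parameter `θ`: the action of period `t` is sampled from
`π_t(H_t)` (with a sampling noise that is independent of `θ` given `H_t`), and
`E[R_t | H_t, θ, A_t] = f_θ(A_t)`. -/
structure IsBanditProcess {Ω E 𝒜 : Type*} [MeasurableSpace Ω] [MeasurableSpace E]
    [MeasurableSpace 𝒜] (μ : Measure Ω) (f : E → 𝒜 → ℝ) (π : Policy 𝒜)
    (θ : Ω → E) (A : ℕ → Ω → 𝒜) (R : ℕ → Ω → ℝ) : Prop where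
  measurable_param : Measurable θ
  measurable_action : ∀ t, Measurable (A t)
  measurable_reward : ∀ t, Measurable (R t)
  integrable_reward : ∀ t, Integrable (R t) μ
  action_law : ∀ t, ∀ B : Set 𝒜, MeasurableSet B →
    μ⟦A t ⁻¹' B | MeasurableSpace.comap (fun ω => (history A R t ω, θ ω)) inferInstance⟧
      =ᵐ[μ] fun ω => (π.kernel t (history A R t ω)).real B
  mean_reward : ∀ t,
    μ[R t | MeasurableSpace.comap (fun ω => (history A R t ω, θ ω, A t ω)) inferInstance]
      =ᵐ[μ] fun ω => f (θ ω) (A t ω)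

/-- Each `Aopt t` is a random action that maximizes the true mean reward function `f_θ`
almost surely. -/
structure IsOptimalAction {Ω E 𝒜 : Type*} [MeasurableSpace Ω] [MeasurableSpace 𝒜]
    (μ : Measure Ω) (f : E → 𝒜 → ℝ) (θ : Ω → E) (Aopt : ℕ → Ω → 𝒜) : Prop where
  measurable_action : ∀ t, Measurable (Aopt t)
  isMax : ∀ t, ∀ᵐ ω ∂μ, ∀ b : 𝒜, f (θ ω) b ≤ f (θ ω) (Aopt t ω)

/-- Posterior sampling with the initial design `a`: in the first `d` periods the policy plays
`a 0, …, a (d - 1)`; in every later period `t` its action distribution is the posterior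
distribution `P(A*_t ∈ · | H_t)` of the optimal action, where `A*_t = Aopt t`. -/
structure IsInitializedPosteriorSampling {Ω 𝒜 : Type*} [MeasurableSpace Ω] [MeasurableSpace 𝒜]
    (μ : Measure Ω) (A : ℕ → Ω → 𝒜) (R : ℕ → Ω → ℝ) (Aopt : ℕ → Ω → 𝒜)
    {d : ℕ} (a : Fin d → 𝒜) (π : Policy 𝒜) : Prop where
  initial : ∀ (t : ℕ) (ht : t < d) (h : Fin t → 𝒜 × ℝ), π.kernel t h = Measure.dirac (a ⟨t, ht⟩)
  posterior : ∀ t, d ≤ t → ∀ B : Set 𝒜, MeasurableSet B →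
    (fun ω => (π.kernel t (history A R t ω)).real B)
      =ᵐ[μ] μ⟦Aopt t ⁻¹' B | MeasurableSpace.comap (history A R t) inferInstance⟧

/-- The regret `max_a f_θ(a) - f_θ(A_t)` of period `t`. -/
def periodRegret {Ω E 𝒜 : Type*} (f : E → 𝒜 → ℝ) (θ : Ω → E) (A : ℕ → Ω → 𝒜)
    (t : ℕ) (ω : Ω) : ℝ :=
  (⨆ b : 𝒜, f (θ ω) b) - f (θ ω) (A t ω)

/-- The Bayesian regret over the first `T` periods. -/
def bayesRegret {Ω E 𝒜 : Type*} [MeasurableSpace Ω] (μ : Measure Ω) (f : E → 𝒜 → ℝ)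
    (θ : Ω → E) (A : ℕ → Ω → 𝒜) (T : ℕ) : ℝ :=
  ∑ t ∈ Finset.range T, ∫ ω, periodRegret f θ A t ω ∂μ

/-- The generalized linear model `f_ρ(a) = g(⟨φ(a), ρ⟩)`. -/
def glm {d : ℕ} {𝒜 : Type*} (g : ℝ → ℝ) (φ : 𝒜 → EuclideanSpace ℝ (Fin d))
    (ρ : EuclideanSpace ℝ (Fin d)) (b : 𝒜) : ℝ :=
  g (inner ℝ (φ b) ρ)

/-- The slopes `g'(⟨φ(a), ρ⟩)` of the inverse link function, where `a` is an action and `ρ` ranges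
over the convex hull of the parameter set `Θ` (which is `Θ` itself if `Θ` is convex). -/
def slopes {d : ℕ} {𝒜 : Type*} (g : ℝ → ℝ) (φ : 𝒜 → EuclideanSpace ℝ (Fin d))
    (Θ : Set (EuclideanSpace ℝ (Fin d))) : Set ℝ :=
  {s | ∃ ρ ∈ convexHull ℝ Θ, ∃ b : 𝒜, s = deriv g (inner ℝ (φ b) ρ)}

/-- The ratio `r` between the largest and the smallest slope. -/
def slopeRatio {d : ℕ} {𝒜 : Type*} (g : ℝ → ℝ) (φ : 𝒜 → EuclideanSpace ℝ (Fin d))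
    (Θ : Set (EuclideanSpace ℝ (Fin d))) : ℝ :=
  sSup (slopes g φ Θ) / sInf (slopes g φ Θ)

end

open scoped Matrix

namespace PosteriorSampling

/-! The argument needs no estimator, confidence set or concentration inequality. Given `H_t`, let
`(θ', Y')` be an independent copy of `(θ, φ(A*_t))`. Posterior sampling makes `(H_t, θ, φ(A_t))`
equal in law to `(H_t, θ, Y')`, so the expected regret of period `t` is `E[g⟨Y', θ'⟩ - g⟨Y', θ⟩]`:
one feature, two parameters (`exists_conditional_copy`, `integral_periodRegret_le`).

Let `W` be the regularized design matrix. The two scores (feature-weighted sums of residuals) differ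
by an expression free of the rewards. As the slopes of `g` are bounded below, this difference
controls `θ' - θ` in the `W`-norm. Young's inequality then bounds the regret by `r` times `η ‖Y'‖²`
plus `1/η` times the squared norms of the two scores, all in the `W⁻¹`-norm (`glm_sub_le`). Given
`H_t`, `θ'` has the law of `θ`, so only the score at the true parameter matters. That score is a
martingale, and its expected squared norm grows by at most `C²` times that of the played feature
(`integral_scoreForm_succ_le`).

The squared norms of the played features sum to `O(d log T)` (`sum_invForm_design_le`). Choosing `η
= √T` gives `O(r d log T √T)`, which is stronger than the claim; the first `d` periods cost at most
`C` each. -/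

/-- The quadratic form `vᵀ W⁻¹ v`. -/
noncomputable def invForm {d : ℕ} (W : Matrix (Fin d) (Fin d) ℝ) (v : Fin d → ℝ) : ℝ :=
  v ⬝ᵥ (W⁻¹ *ᵥ v)

/-- The regularized design matrix `lam • 1 + ∑ k, v k (v k)ᵀ`. -/
def design {d t : ℕ} (lam : ℝ) (v : Fin t → Fin d → ℝ) : Matrix (Fin d) (Fin d) ℝ :=
  lam • 1 + ∑ k, Matrix.vecMulVec (v k) (v k)

/-! ### Inverse quadratic forms and the elliptical potential. -/

section LinearAlgebra

variable {d : ℕ} {W : Matrix (Fin d) (Fin d) ℝ}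

lemma form_symm (hW : W.PosDef) (u v : Fin d → ℝ) : u ⬝ᵥ (W *ᵥ v) = v ⬝ᵥ (W *ᵥ u) := by
  have h : Wᵀ = W := by simpa [Matrix.IsHermitian] using hW.isHermitian
  rw [Matrix.dotProduct_mulVec, ← Matrix.mulVec_transpose, h, dotProduct_comm]

lemma form_nonneg (hW : W.PosDef) (u : Fin d → ℝ) : 0 ≤ u ⬝ᵥ (W *ᵥ u) := by
  simpa using hW.posSemidef.dotProduct_mulVec_nonneg u

lemma mulVec_inv_mulVec (hW : W.PosDef) (v : Fin d → ℝ) : W *ᵥ (W⁻¹ *ᵥ v) = v := by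
  rw [Matrix.mulVec_mulVec, Matrix.mul_nonsing_inv _ hW.det_pos.ne'.isUnit, Matrix.one_mulVec]

lemma invForm_nonneg (hW : W.PosDef) (v : Fin d → ℝ) : 0 ≤ invForm W v :=
  form_nonneg hW.inv v

/-- Expand the form of `W` at `u - W⁻¹ v`. With the equality case `invForm_eq` at `u = W⁻¹ v`, this
exhibits `invForm W v` as a maximum over `u`. -/
lemma two_mul_dotProduct_sub_form_le (hW : W.PosDef) (u v : Fin d → ℝ) :
    2 * (u ⬝ᵥ v) - u ⬝ᵥ (W *ᵥ u) ≤ invForm W v := by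
  have h := form_nonneg hW (u - W⁻¹ *ᵥ v)
  rw [Matrix.mulVec_sub, mulVec_inv_mulVec hW, sub_dotProduct, dotProduct_sub, dotProduct_sub,
    form_symm hW (W⁻¹ *ᵥ v) u, mulVec_inv_mulVec hW, dotProduct_comm (W⁻¹ *ᵥ v) v] at h
  unfold invForm
  linarith

lemma invForm_eq (hW : W.PosDef) (v : Fin d → ℝ) :
    invForm W v = 2 * ((W⁻¹ *ᵥ v) ⬝ᵥ v) - (W⁻¹ *ᵥ v) ⬝ᵥ (W *ᵥ (W⁻¹ *ᵥ v)) := by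
  rw [mulVec_inv_mulVec hW, dotProduct_comm (W⁻¹ *ᵥ v) v, invForm]
  ring

lemma young_form (hW : W.PosDef) (u v : Fin d → ℝ) {b : ℝ} (hb : 0 < b) :
    2 * (u ⬝ᵥ v) ≤ b * (u ⬝ᵥ (W *ᵥ u)) + b⁻¹ * invForm W v := by
  have h := two_mul_dotProduct_sub_form_le hW (b • u) v
  simp only [smul_dotProduct, Matrix.mulVec_smul, dotProduct_smul, smul_eq_mul] at h
  have h2 := mul_le_mul_of_nonneg_left h (inv_pos.2 hb).le
  have : b⁻¹ * (2 * (b * (u ⬝ᵥ v)) - b * (b * (u ⬝ᵥ (W *ᵥ u))))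
      = 2 * (u ⬝ᵥ v) - b * (u ⬝ᵥ (W *ᵥ u)) := by field_simp
  linarith

/-- The maximizer for `W'` is a competitor in the variational problem for `W`. -/
lemma invForm_anti {W' : Matrix (Fin d) (Fin d) ℝ} (hW : W.PosDef) (hW' : W'.PosDef)
    (h : ∀ u : Fin d → ℝ, u ⬝ᵥ (W *ᵥ u) ≤ u ⬝ᵥ (W' *ᵥ u)) (v : Fin d → ℝ) :
    invForm W' v ≤ invForm W v := by
  rw [invForm_eq hW']
  exact (sub_le_sub_left (h _) _).trans (two_mul_dotProduct_sub_form_le hW _ v)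

lemma invForm_add (hW : W.PosDef) (u v : Fin d → ℝ) :
    invForm W (u + v) = invForm W u + 2 * (u ⬝ᵥ (W⁻¹ *ᵥ v)) + invForm W v := by
  simp only [invForm, Matrix.mulVec_add, add_dotProduct, dotProduct_add, form_symm hW.inv v u]
  ring

lemma invForm_smul (c : ℝ) (v : Fin d → ℝ) : invForm W (c • v) = c ^ 2 * invForm W v := by
  simp only [invForm, Matrix.mulVec_smul, smul_dotProduct, dotProduct_smul, smul_eq_mul]
  ring

lemma invForm_sub_le (hW : W.PosDef) (u v : Fin d → ℝ) :
    invForm W (u - v) ≤ 2 * invForm W u + 2 * invForm W v := by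
  have h1 := invForm_nonneg hW (u + v)
  have h2 : invForm W (u - v) = invForm W u - 2 * (u ⬝ᵥ (W⁻¹ *ᵥ v)) + invForm W v := by
    have h := invForm_add hW u ((-1 : ℝ) • v)
    rw [invForm_smul, Matrix.mulVec_smul, dotProduct_smul] at h
    rw [sub_eq_add_neg, ← neg_one_smul ℝ v, h, smul_eq_mul]
    ring
  rw [invForm_add hW] at h1
  linarith

lemma det_add_vecMulVec (hW : W.PosDef) (v : Fin d → ℝ) :
    (W + Matrix.vecMulVec v v).det = W.det * (1 + invForm W v) := by
  rw [Matrix.vecMulVec_eq Unit,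
    Matrix.det_add_replicateCol_mul_replicateRow hW.det_pos.ne'.isUnit]
  congr 2
  simp [invForm, Matrix.mul_apply, Matrix.replicateRow, Matrix.replicateCol, dotProduct,
    Matrix.mulVec, Finset.mul_sum, Finset.sum_mul, mul_assoc]
  exact Finset.sum_comm

lemma vecMulVec_form (v u : Fin d → ℝ) :
    u ⬝ᵥ (Matrix.vecMulVec v v *ᵥ u) = (v ⬝ᵥ u) ^ 2 := by
  rw [Matrix.vecMulVec_mulVec]
  simp [dotProduct_comm u v, sq]

variable {t : ℕ} {lam : ℝ}

lemma design_form (lam : ℝ) (v : Fin t → Fin d → ℝ) (u : Fin d → ℝ) :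
    u ⬝ᵥ (design lam v *ᵥ u) = lam * (u ⬝ᵥ u) + ∑ k, (v k ⬝ᵥ u) ^ 2 := by
  simp only [design, Matrix.add_mulVec, dotProduct_add, Matrix.smul_mulVec, Matrix.one_mulVec,
    dotProduct_smul, smul_eq_mul, Matrix.sum_mulVec, dotProduct_sum, vecMulVec_form]

lemma design_posDef (hlam : 0 < lam) (v : Fin t → Fin d → ℝ) : (design lam v).PosDef := by
  refine Matrix.PosDef.add_posSemidef (Matrix.PosDef.one.smul hlam) ?_
  refine Matrix.posSemidef_sum _ fun k _ => ?_
  simpa using Matrix.posSemidef_vecMulVec_self_star (v k)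

lemma design_succ (lam : ℝ) (v : Fin (t + 1) → Fin d → ℝ) :
    design lam v = design lam (fun k : Fin t => v k.castSucc)
      + Matrix.vecMulVec (v (Fin.last t)) (v (Fin.last t)) := by
  simp [design, Fin.sum_univ_castSucc, add_assoc]

lemma invForm_design_le (hlam : 0 < lam) (v : Fin t → Fin d → ℝ) (u : Fin d → ℝ) :
    invForm (design lam v) u ≤ (u ⬝ᵥ u) / lam := by
  have hW := design_posDef hlam v
  have h : ∀ w : Fin d → ℝ, w ⬝ᵥ ((lam • (1 : Matrix (Fin d) (Fin d) ℝ)) *ᵥ w)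
      ≤ w ⬝ᵥ (design lam v *ᵥ w) := fun w => by
    rw [design_form, Matrix.smul_mulVec, Matrix.one_mulVec, dotProduct_smul, smul_eq_mul]
    exact le_add_of_nonneg_right (Finset.sum_nonneg fun _ _ => sq_nonneg _)
  have hP : (lam • (1 : Matrix (Fin d) (Fin d) ℝ)).PosDef := Matrix.PosDef.one.smul hlam
  refine (invForm_anti hP hW h u).trans (le_of_eq ?_)
  have hinv : (lam • (1 : Matrix (Fin d) (Fin d) ℝ))⁻¹ = lam⁻¹ • 1 :=
    Matrix.inv_eq_right_inv (by simp [hlam.ne'])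
  rw [invForm, hinv, Matrix.smul_mulVec, Matrix.one_mulVec, dotProduct_smul, smul_eq_mul]
  field_simp

lemma invForm_design_succ_le (hlam : 0 < lam) (v : Fin (t + 1) → Fin d → ℝ) (u : Fin d → ℝ) :
    invForm (design lam v) u ≤ invForm (design lam fun k : Fin t => v k.castSucc) u := by
  refine invForm_anti (design_posDef hlam _) (design_posDef hlam _) (fun w => ?_) u
  rw [design_form, design_form, Fin.sum_univ_castSucc, ← add_assoc]
  exact le_add_of_nonneg_right (sq_nonneg _)

/-- Testing the hypothesis on unit eigenvectors bounds every eigenvalue by `c`. -/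
lemma det_le_pow_of_form_le (hW : W.PosDef) {c : ℝ}
    (h : ∀ u : Fin d → ℝ, u ⬝ᵥ (W *ᵥ u) ≤ c * (u ⬝ᵥ u)) : W.det ≤ c ^ d := by
  have hdet := hW.isHermitian.det_eq_prod_eigenvalues
  simp only [RCLike.ofReal_real_eq_id, id] at hdet
  rw [hdet]
  have : c ^ d = ∏ _i : Fin d, c := by simp
  rw [this]
  refine Finset.prod_le_prod (fun i _ => (hW.eigenvalues_pos i).le) fun i _ => ?_
  have h1 := h (hW.isHermitian.eigenvectorBasis i).ofLp
  rw [hW.isHermitian.mulVec_eigenvectorBasis i, dotProduct_smul, smul_eq_mul] at h1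
  have h2 : (hW.isHermitian.eigenvectorBasis i).ofLp ⬝ᵥ (hW.isHermitian.eigenvectorBasis i).ofLp
      = 1 := by
    have h3 := real_inner_self_eq_norm_sq (hW.isHermitian.eigenvectorBasis i)
    rw [hW.isHermitian.eigenvectorBasis.norm_eq_one i, EuclideanSpace.inner_eq_star_dotProduct] at h3
    simpa using h3
  rw [h2] at h1
  linarith

lemma sq_dotProduct_le (u v : Fin d → ℝ) : (u ⬝ᵥ v) ^ 2 ≤ (u ⬝ᵥ u) * (v ⬝ᵥ v) := by
  have := Finset.sum_mul_sq_le_sq_mul_sq Finset.univ u v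
  simpa [dotProduct, sq] using this

lemma det_design_le (hlam : 0 < lam) (v : Fin t → Fin d → ℝ) {c : ℝ}
    (hv : ∀ k, v k ⬝ᵥ v k ≤ c) : (design lam v).det ≤ (lam + t * c) ^ d := by
  refine det_le_pow_of_form_le (design_posDef hlam v) fun u => ?_
  rw [design_form, add_mul]
  gcongr
  have hu : 0 ≤ u ⬝ᵥ u := Finset.sum_nonneg fun i _ => mul_self_nonneg _
  calc ∑ k, (v k ⬝ᵥ u) ^ 2 ≤ ∑ _k : Fin t, c * (u ⬝ᵥ u) :=
        Finset.sum_le_sum fun k _ => (sq_dotProduct_le _ _).trans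
          (mul_le_mul_of_nonneg_right (hv k) hu)
    _ = t * c * (u ⬝ᵥ u) := by simp [mul_assoc]

lemma det_design_pos (hlam : 0 < lam) (v : Fin t → Fin d → ℝ) : 0 < (design lam v).det :=
  (design_posDef hlam v).det_pos

/-- Follows from `log (1 + x) ≥ x / (1 + x)`; it turns increments of the potential into increments
of a log determinant. -/
lemma le_mul_log_one_add {x M : ℝ} (hx : 0 ≤ x) (hM : x ≤ M) :
    x ≤ (1 + M) * Real.log (1 + x) := by
  have h1 : 1 - (1 + x)⁻¹ ≤ Real.log (1 + x) := Real.one_sub_inv_le_log_of_pos (by linarith)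
  have h2 : x = (1 + x) * (1 - (1 + x)⁻¹) := by
    have : 1 + x ≠ 0 := by linarith
    field_simp
    ring
  calc x = (1 + x) * (1 - (1 + x)⁻¹) := h2
    _ ≤ (1 + x) * Real.log (1 + x) := by gcongr
    _ ≤ (1 + M) * Real.log (1 + x) := by
      gcongr
      exact Real.log_nonneg (by linarith)

/-- The elliptical potential bound. -/
lemma sum_invForm_design_le (hlam : 0 < lam) {c : ℝ} (v : ℕ → Fin d → ℝ)
    (hv : ∀ k, v k ⬝ᵥ v k ≤ c) (T : ℕ) :
    ∑ t ∈ Finset.range T, invForm (design lam fun k : Fin t => v k) (v t)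
      ≤ (1 + c / lam) * (d * Real.log (1 + T * (c / lam))) := by
  have hc : 0 ≤ c := le_trans (Finset.sum_nonneg fun i _ => mul_self_nonneg _) (hv 0)
  have hM : 0 ≤ c / lam := div_nonneg hc hlam.le
  -- Each rank-one update adds `log (1 + x)` to the log determinant, so the sum telescopes; `d * log
  -- lam` is the initial value.
  have key : ∑ t ∈ Finset.range T, invForm (design lam fun k : Fin t => v k) (v t)
      ≤ (1 + c / lam) * (Real.log (design lam fun k : Fin T => v k).det - d * Real.log lam) := by
    induction T with
    | zero => simp [design, Real.log_pow]
    | succ T ih =>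
      rw [Finset.sum_range_succ, design_succ]
      simp only [Fin.val_castSucc, Fin.val_last]
      have hx := invForm_nonneg (design_posDef hlam fun k : Fin T => v k) (v T)
      have hle : invForm (design lam fun k : Fin T => v k) (v T) ≤ c / lam :=
        (invForm_design_le hlam _ _).trans (by gcongr; exact hv T)
      rw [det_add_vecMulVec (design_posDef hlam _),
        Real.log_mul (det_design_pos hlam _).ne' (by linarith)]
      have := le_mul_log_one_add hx hle
      linarith
  refine key.trans ?_
  gcongr
  have h1 : Real.log (design lam fun k : Fin T => v k).det ≤ d * Real.log (lam + T * c) := by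
    rw [← Real.log_pow]
    exact Real.log_le_log (det_design_pos hlam _) (det_design_le hlam _ fun k => hv k)
  have h2 : Real.log (lam + T * c) = Real.log lam + Real.log (1 + T * (c / lam)) := by
    rw [← Real.log_mul hlam.ne' (by positivity)]
    congr 1
    field_simp
  rw [h2] at h1
  linarith

end LinearAlgebra

/-! ### Measurability of matrix expressions. -/

section Measurability

variable {α : Type*} [MeasurableSpace α] {d : ℕ}

lemma measurable_dotProduct {u v : α → Fin d → ℝ} (hu : Measurable u) (hv : Measurable v) :
    Measurable fun x => u x ⬝ᵥ v x := by
  unfold dotProduct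
  fun_prop

lemma measurable_inv_mulVec {W : α → Matrix (Fin d) (Fin d) ℝ} {v : α → Fin d → ℝ}
    (hW : ∀ i j, Measurable fun x => W x i j) (hv : Measurable v) :
    Measurable fun x => (W x)⁻¹ *ᵥ v x := by
  have hW' : Measurable fun x => (fun i j => W x i j : Fin d → Fin d → ℝ) :=
    measurable_pi_lambda _ fun i => measurable_pi_lambda _ fun j => hW i j
  have hc : Continuous fun M : Fin d → Fin d → ℝ => Matrix.of M := continuous_id
  have hdet : Measurable fun x => (W x).det := by
    have h : Continuous fun M : Fin d → Fin d → ℝ => (Matrix.of M).det := hc.matrix_det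
    exact h.measurable.comp hW'
  have hadj : ∀ i j, Measurable fun x => (W x).adjugate i j := fun i j => by
    have h : Continuous fun M : Fin d → Fin d → ℝ => (Matrix.of M).adjugate i j :=
      hc.matrix_adjugate.matrix_elem i j
    exact h.measurable.comp hW'
  have hinv : ∀ i j, Measurable fun x => (W x)⁻¹ i j := fun i j => by
    -- Inversion is not continuous at singular matrices, but determinant and adjugate are, and
    -- scalar inversion is Borel.
    simp only [Matrix.inv_def, Ring.inverse_eq_inv', Matrix.smul_apply, smul_eq_mul]
    exact hdet.inv.mul (hadj i j)
  refine measurable_pi_lambda _ fun i => ?_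
  exact measurable_dotProduct (measurable_pi_lambda _ fun j => hinv i j) hv

lemma measurable_invForm {W : α → Matrix (Fin d) (Fin d) ℝ} {v : α → Fin d → ℝ}
    (hW : ∀ i j, Measurable fun x => W x i j) (hv : Measurable v) :
    Measurable fun x => invForm (W x) (v x) :=
  measurable_dotProduct hv (measurable_inv_mulVec hW hv)

lemma measurable_design {t : ℕ} (lam : ℝ) {v : α → Fin t → Fin d → ℝ}
    (hv : ∀ k, Measurable fun x => v x k) (i j : Fin d) :
    Measurable fun x => design lam (v x) i j := by
  have h : ∀ k i, Measurable fun x => v x k i := fun k i => (measurable_pi_apply i).comp (hv k)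
  simp only [design, Matrix.add_apply, Matrix.sum_apply, Matrix.vecMulVec_apply]
  exact measurable_const.add (Finset.measurable_sum _ fun k _ => (h k i).mul (h k j))

end Measurability

/-! ### Conditionally independent copies given the history. -/

section ConditionalCopy

variable {Ω Hs E F : Type*} [MeasurableSpace Ω] [MeasurableSpace Hs]
  [MeasurableSpace E] [StandardBorelSpace E] [Nonempty E]
  [MeasurableSpace F] [StandardBorelSpace F] [Nonempty F]
  {μ : Measure Ω} [IsProbabilityMeasure μ] {H : Ω → Hs} {θ : Ω → E} {X Y : Ω → F}

/-- The conditional probability of `X ∈ B` given `(H, θ)` depends on `H` alone and is the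
`Y`-marginal of the conditional law; integrate it over the event `(H, θ) ∈ G`. -/
lemma measure_inter_eq_setLIntegral_condDistrib
    (hH : Measurable H) (hθ : Measurable θ) (hX : Measurable X) (hY : Measurable Y)
    {B : Set F} (hB : MeasurableSet B)
    (h : μ⟦X ⁻¹' B | MeasurableSpace.comap (fun ω => (H ω, θ ω)) inferInstance⟧
      =ᵐ[μ] μ⟦Y ⁻¹' B | MeasurableSpace.comap H inferInstance⟧)
    {G : Set (Hs × E)} (hG : MeasurableSet G) :
    μ ((fun ω => (H ω, θ ω)) ⁻¹' G ∩ X ⁻¹' B)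
      = ∫⁻ ω in (fun ω => (H ω, θ ω)) ⁻¹' G,
          condDistrib (fun ω => (θ ω, Y ω)) H μ (H ω) (Prod.snd ⁻¹' B) ∂μ := by
  have hHθ : Measurable fun ω => (H ω, θ ω) := hH.prodMk hθ
  have hGm : MeasurableSet ((fun ω => (H ω, θ ω)) ⁻¹' G) := hHθ hG
  have hXB : MeasurableSet (X ⁻¹' B) := hX hB
  have e1 : ∫ ω in (fun ω => (H ω, θ ω)) ⁻¹' G, (X ⁻¹' B).indicator (fun _ => (1 : ℝ)) ω ∂μ
      = ∫ ω in (fun ω => (H ω, θ ω)) ⁻¹' G,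
        (condDistrib (fun ω => (θ ω, Y ω)) H μ (H ω)).real (Prod.snd ⁻¹' B) ∂μ := by
    rw [← setIntegral_condExp hHθ.comap_le ((integrable_const (1 : ℝ)).indicator hXB) ⟨G, hG, rfl⟩]
    refine setIntegral_congr_ae hGm ?_
    have h2 := condDistrib_ae_eq_condExp (μ := μ) hH (hθ.prodMk hY) (measurable_snd hB)
    filter_upwards [h, h2] with ω h1 h2 _
    rw [h2]
    exact h1
  rw [integral_indicator_const _ hXB, smul_eq_mul, mul_one] at e1
  have hm : Measurable fun ω => condDistrib (fun ω => (θ ω, Y ω)) H μ (H ω) (Prod.snd ⁻¹' B) :=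
    (Kernel.measurable_coe _ (measurable_snd hB)).comp hH
  have hr : ∫ ω in (fun ω => (H ω, θ ω)) ⁻¹' G,
        (condDistrib (fun ω => (θ ω, Y ω)) H μ (H ω)).real (Prod.snd ⁻¹' B) ∂μ
      = (∫⁻ ω in (fun ω => (H ω, θ ω)) ⁻¹' G,
          condDistrib (fun ω => (θ ω, Y ω)) H μ (H ω) (Prod.snd ⁻¹' B) ∂μ).toReal :=
    integral_toReal hm.aemeasurable (ae_of_all _ fun ω => measure_lt_top _ _)
  rw [hr, measureReal_def] at e1
  rw [Measure.restrict_apply hXB, Set.inter_comm] at e1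
  refine (ENNReal.toReal_eq_toReal_iff' (measure_ne_top _ _) ?_).1 e1
  refine ne_of_lt (lt_of_le_of_lt (lintegral_mono fun ω => prob_le_one) ?_)
  simp

/-- Take for `κ` the conditional law of `(θ, Y)` given `H`. Given `H`, `X` is independent of `θ` and
distributed as `Y`, so the conditional law of `(θ, X)` is the product of the marginals of `κ`. -/
lemma exists_conditional_kernel
    (hH : Measurable H) (hθ : Measurable θ) (hX : Measurable X) (hY : Measurable Y)
    (h : ∀ B, MeasurableSet B →
      μ⟦X ⁻¹' B | MeasurableSpace.comap (fun ω => (H ω, θ ω)) inferInstance⟧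
        =ᵐ[μ] μ⟦Y ⁻¹' B | MeasurableSpace.comap H inferInstance⟧) :
    ∃ κ : Kernel Hs (E × F), IsMarkovKernel κ ∧
      μ.map H ⊗ₘ κ = μ.map (fun ω => (H ω, θ ω, Y ω)) ∧
      μ.map H ⊗ₘ (κ.fst ×ₖ κ.snd) = μ.map (fun ω => (H ω, θ ω, X ω)) := by
  have hZ : Measurable fun ω => (θ ω, Y ω) := hθ.prodMk hY
  set κ := condDistrib (fun ω => (θ ω, Y ω)) H μ with hκ
  have hcomp : μ.map H ⊗ₘ κ = μ.map (fun ω => (H ω, θ ω, Y ω)) :=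
    compProd_map_condDistrib hZ.aemeasurable
  have : IsProbabilityMeasure (μ.map H) := Measure.isProbabilityMeasure_map hH.aemeasurable
  refine ⟨κ, inferInstance, hcomp, ?_⟩
  refine Measure.ext_prod₃ fun {s t u} hs ht hu => ?_
  have hpre : (fun ω => (H ω, θ ω, X ω)) ⁻¹' (s ×ˢ t ×ˢ u)
      = (fun ω => (H ω, θ ω)) ⁻¹' (s ×ˢ t) ∩ X ⁻¹' u := by
    ext ω
    simp [and_assoc]
  rw [Measure.map_apply (hH.prodMk (hθ.prodMk hX)) (hs.prod (ht.prod hu)), hpre,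
    measure_inter_eq_setLIntegral_condDistrib hH hθ hX hY hu (h u hu) (hs.prod ht),
    Measure.compProd_apply_prod hs (ht.prod hu)]
  have hmκ : Measurable fun x : Hs => κ x (Prod.snd ⁻¹' u) :=
    Kernel.measurable_coe _ (measurable_snd hu)
  have hS : MeasurableSet (s ×ˢ (t ×ˢ (Set.univ : Set F))) := hs.prod (ht.prod .univ)
  have hf : Measurable fun p : Hs × E × F => κ p.1 (Prod.snd ⁻¹' u) := hmκ.comp measurable_fst
  have e : ∫⁻ ω in (fun ω => (H ω, θ ω)) ⁻¹' (s ×ˢ t), κ (H ω) (Prod.snd ⁻¹' u) ∂μ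
      = ∫⁻ p in s ×ˢ (t ×ˢ (Set.univ : Set F)), κ p.1 (Prod.snd ⁻¹' u) ∂(μ.map H ⊗ₘ κ) := by
    rw [hcomp, setLIntegral_map hS hf (hH.prodMk hZ)]
    congr 2
    ext ω
    simp
  rw [e, Measure.setLIntegral_compProd hf hs (ht.prod .univ)]
  refine lintegral_congr fun x => ?_
  dsimp only
  rw [lintegral_const, Kernel.prod_apply, Measure.prod_prod, Kernel.fst_apply' _ _ ht,
    Kernel.snd_apply' _ _ hu, Measure.restrict_apply .univ, mul_comm]
  congr 2
  ext p
  simp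

/-- A coupling of the joint law of history, parameter and optimal action with a copy that is
conditionally independent given the history. -/
lemma exists_conditional_copy
    (hH : Measurable H) (hθ : Measurable θ) (hX : Measurable X) (hY : Measurable Y)
    (h : ∀ B, MeasurableSet B →
      μ⟦X ⁻¹' B | MeasurableSpace.comap (fun ω => (H ω, θ ω)) inferInstance⟧
        =ᵐ[μ] μ⟦Y ⁻¹' B | MeasurableSpace.comap H inferInstance⟧) :
    ∃ Ψ : Measure (Hs × (E × F) × (E × F)), IsProbabilityMeasure Ψ ∧
      Ψ.map (fun q => (q.1, q.2.1)) = μ.map (fun ω => (H ω, θ ω, Y ω)) ∧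
      Ψ.map (fun q => (q.1, q.2.2)) = μ.map (fun ω => (H ω, θ ω, Y ω)) ∧
      Ψ.map (fun q => (q.1, q.2.1.1, q.2.2.2)) = μ.map (fun ω => (H ω, θ ω, X ω)) := by
  obtain ⟨κ, hκ, h1, h2⟩ := exists_conditional_kernel hH hθ hX hY h
  have : IsProbabilityMeasure (μ.map H) := Measure.isProbabilityMeasure_map hH.aemeasurable
  -- Two independent draws from `κ`: the parameter of one and the feature of the other have the
  -- product of the marginals as joint law.
  refine ⟨μ.map H ⊗ₘ (κ ×ₖ κ), inferInstance, ?_, ?_, ?_⟩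
  · rw [← h1]
    refine Measure.ext_of_lintegral _ fun f hf => ?_
    rw [lintegral_map hf (by fun_prop), Measure.lintegral_compProd (by fun_prop),
      Measure.lintegral_compProd hf]
    refine lintegral_congr fun x => ?_
    rw [Kernel.prod_apply, lintegral_prod _ (by fun_prop)]
    simp
  · rw [← h1]
    refine Measure.ext_of_lintegral _ fun f hf => ?_
    rw [lintegral_map hf (by fun_prop), Measure.lintegral_compProd (by fun_prop),
      Measure.lintegral_compProd hf]
    refine lintegral_congr fun x => ?_
    rw [Kernel.prod_apply, lintegral_prod _ (by fun_prop)]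
    simp
  · rw [← h2]
    refine Measure.ext_of_lintegral _ fun f hf => ?_
    rw [lintegral_map hf (by fun_prop), Measure.lintegral_compProd (by fun_prop),
      Measure.lintegral_compProd hf]
    refine lintegral_congr fun x => ?_
    rw [Kernel.prod_apply, Kernel.prod_apply, Kernel.fst_apply, Kernel.snd_apply,
      Measure.map_prod_map _ _ measurable_fst measurable_snd,
      lintegral_map (by fun_prop) (by fun_prop)]
    rfl

/-- If a rectangle is null for the product of the marginals, one of its sides is null, hence so is
the rectangle for the joint law. -/
lemma map_prod_eq_zero_of_copy
    (hH : Measurable H) (hθ : Measurable θ) (hX : Measurable X) (hY : Measurable Y)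
    (h : ∀ B, MeasurableSet B →
      μ⟦X ⁻¹' B | MeasurableSpace.comap (fun ω => (H ω, θ ω)) inferInstance⟧
        =ᵐ[μ] μ⟦Y ⁻¹' B | MeasurableSpace.comap H inferInstance⟧)
    {U : Set E} {V : Set F} (hU : MeasurableSet U) (hV : MeasurableSet V)
    (h0 : μ {ω | θ ω ∈ U ∧ X ω ∈ V} = 0) : μ {ω | θ ω ∈ U ∧ Y ω ∈ V} = 0 := by
  obtain ⟨κ, hκ, h1, h2⟩ := exists_conditional_kernel hH hθ hX hY h
  have : IsProbabilityMeasure (μ.map H) := Measure.isProbabilityMeasure_map hH.aemeasurable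
  have hS : MeasurableSet ((Set.univ : Set Hs) ×ˢ U ×ˢ V) := MeasurableSet.univ.prod (hU.prod hV)
  have a1 : (μ.map H ⊗ₘ (κ.fst ×ₖ κ.snd)) (Set.univ ×ˢ U ×ˢ V) = 0 := by
    rw [h2, Measure.map_apply (hH.prodMk (hθ.prodMk hX)) hS, ← h0]
    congr 1
    ext ω
    simp
  have a2 : μ {ω | θ ω ∈ U ∧ Y ω ∈ V} = (μ.map H ⊗ₘ κ) (Set.univ ×ˢ U ×ˢ V) := by
    rw [h1, Measure.map_apply (hH.prodMk (hθ.prodMk hY)) hS]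
    congr 1
    ext ω
    simp
  rw [a2, Measure.compProd_apply_prod .univ (hU.prod hV), Measure.restrict_univ,
    lintegral_eq_zero_iff (Kernel.measurable_coe _ (hU.prod hV))]
  rw [Measure.compProd_apply_prod .univ (hU.prod hV), Measure.restrict_univ,
    lintegral_eq_zero_iff (Kernel.measurable_coe _ (hU.prod hV))] at a1
  filter_upwards [a1] with x hx
  rw [Kernel.prod_apply, Measure.prod_prod, Kernel.fst_apply' _ _ hU, Kernel.snd_apply' _ _ hV,
    Pi.zero_apply, mul_eq_zero] at hx
  rcases hx with hx | hx
  · exact measure_mono_null (fun p hp => hp.1) hx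
  · exact measure_mono_null (fun p hp => hp.2) hx

/-- The complement of a closed set is locally covered by open rectangles, each null by
`map_prod_eq_zero_of_copy`. Closedness matters: a joint law carried by a diagonal may be singular to
the product of its marginals. -/
lemma ae_mem_of_copy [TopologicalSpace E] [SecondCountableTopology E] [BorelSpace E]
    [TopologicalSpace F] [SecondCountableTopology F] [BorelSpace F]
    (hH : Measurable H) (hθ : Measurable θ) (hX : Measurable X) (hY : Measurable Y)
    (h : ∀ B, MeasurableSet B →
      μ⟦X ⁻¹' B | MeasurableSpace.comap (fun ω => (H ω, θ ω)) inferInstance⟧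
        =ᵐ[μ] μ⟦Y ⁻¹' B | MeasurableSpace.comap H inferInstance⟧)
    {K : Set (E × F)} (hK : IsClosed K) (hXK : ∀ᵐ ω ∂μ, (θ ω, X ω) ∈ K) :
    ∀ᵐ ω ∂μ, (θ ω, Y ω) ∈ K := by
  have hZ : Measurable fun ω => (θ ω, Y ω) := hθ.prodMk hY
  have hnull : (μ.map fun ω => (θ ω, Y ω)) Kᶜ = 0 := by
    refine measure_null_of_locally_null _ fun p hp => ?_
    obtain ⟨U, V, hU, hpU, hV, hpV, hUV⟩ := mem_nhds_prod_iff'.1 (hK.isOpen_compl.mem_nhds hp)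
    refine ⟨U ×ˢ V, mem_nhdsWithin_of_mem_nhds
      ((hU.prod hV).mem_nhds ⟨hpU, hpV⟩), ?_⟩
    rw [Measure.map_apply hZ (hU.prod hV).measurableSet]
    refine map_prod_eq_zero_of_copy hH hθ hX hY h hU.measurableSet hV.measurableSet ?_
    refine measure_mono_null (fun ω hω => ?_) hXK
    exact fun hmem => hUV ⟨hω.1, hω.2⟩ hmem
  rw [Measure.map_apply hZ hK.isOpen_compl.measurableSet] at hnull
  exact hnull

end ConditionalCopy

/-! ### Score, features and design matrix of a history. -/

lemma ofLp_dotProduct_self {d : ℕ} (x : EuclideanSpace ℝ (Fin d)) :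
    x.ofLp ⬝ᵥ x.ofLp = ‖x‖ ^ 2 := by
  rw [← real_inner_self_eq_norm_sq, EuclideanSpace.inner_eq_star_dotProduct]
  simp

lemma inner_eq_dotProduct {d : ℕ} (x y : EuclideanSpace ℝ (Fin d)) :
    inner ℝ x y = x.ofLp ⬝ᵥ y.ofLp := by
  rw [EuclideanSpace.inner_eq_star_dotProduct, dotProduct_comm]
  simp

/-- The regularized design matrix of a history. -/
def historyDesign {d t : ℕ} {𝒜 : Type*} (lam : ℝ) (φ : 𝒜 → EuclideanSpace ℝ (Fin d))
    (h : Fin t → 𝒜 × ℝ) : Matrix (Fin d) (Fin d) ℝ :=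
  design lam fun k => (φ (h k).1).ofLp

/-- The sum of the residuals of a history under the parameter `ρ`, weighted by the features. -/
noncomputable def score {d t : ℕ} {𝒜 : Type*} (g : ℝ → ℝ) (φ : 𝒜 → EuclideanSpace ℝ (Fin d))
    (h : Fin t → 𝒜 × ℝ) (ρ : EuclideanSpace ℝ (Fin d)) : Fin d → ℝ :=
  ∑ k, ((h k).2 - glm g φ ρ (h k).1) • (φ (h k).1).ofLp

/-- The squared norm of the score with respect to the inverse design matrix. -/
noncomputable def scoreForm {d t : ℕ} {𝒜 : Type*} (lam : ℝ) (g : ℝ → ℝ)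
    (φ : 𝒜 → EuclideanSpace ℝ (Fin d)) (h : Fin t → 𝒜 × ℝ) (ρ : EuclideanSpace ℝ (Fin d)) : ℝ :=
  invForm (historyDesign lam φ h) (score g φ h ρ)

/-- The inner product of the score and a feature vector with respect to the inverse design
matrix. -/
noncomputable def crossForm {d t : ℕ} {𝒜 : Type*} (lam : ℝ) (g : ℝ → ℝ)
    (φ : 𝒜 → EuclideanSpace ℝ (Fin d)) (h : Fin t → 𝒜 × ℝ) (ρ : EuclideanSpace ℝ (Fin d))
    (b : 𝒜) : ℝ :=
  score g φ h ρ ⬝ᵥ ((historyDesign lam φ h)⁻¹ *ᵥ (φ b).ofLp)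

/-- The squared norm of a feature vector with respect to the inverse design matrix. -/
noncomputable def featureForm {d t : ℕ} {𝒜 : Type*} (lam : ℝ)
    (φ : 𝒜 → EuclideanSpace ℝ (Fin d)) (h : Fin t → 𝒜 × ℝ) (x : EuclideanSpace ℝ (Fin d)) : ℝ :=
  invForm (historyDesign lam φ h) x.ofLp

section History

variable {d t : ℕ} {𝒜 Ω : Type*} {lam c₂ : ℝ} {g : ℝ → ℝ} {φ : 𝒜 → EuclideanSpace ℝ (Fin d)}

lemma historyDesign_posDef (hlam : 0 < lam) (h : Fin t → 𝒜 × ℝ) :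
    (historyDesign lam φ h).PosDef := design_posDef hlam _

lemma scoreForm_nonneg (hlam : 0 < lam) (h : Fin t → 𝒜 × ℝ) (ρ : EuclideanSpace ℝ (Fin d)) :
    0 ≤ scoreForm lam g φ h ρ := invForm_nonneg (historyDesign_posDef hlam h) _

lemma featureForm_nonneg (hlam : 0 < lam) (h : Fin t → 𝒜 × ℝ) (x : EuclideanSpace ℝ (Fin d)) :
    0 ≤ featureForm lam φ h x := invForm_nonneg (historyDesign_posDef hlam h) _

lemma featureForm_le (hlam : 0 < lam) (h : Fin t → 𝒜 × ℝ)
    {x : EuclideanSpace ℝ (Fin d)} (hx : ‖x‖ ≤ c₂) : featureForm lam φ h x ≤ c₂ ^ 2 / lam := by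
  refine (invForm_design_le hlam _ _).trans ?_
  rw [ofLp_dotProduct_self]
  gcongr

lemma score_history_succ (A : ℕ → Ω → 𝒜) (R : ℕ → Ω → ℝ) (ω : Ω)
    (ρ : EuclideanSpace ℝ (Fin d)) :
    score g φ (history A R (t + 1) ω) ρ = score g φ (history A R t ω) ρ
      + (R t ω - glm g φ ρ (A t ω)) • (φ (A t ω)).ofLp := by
  simp [score, history, Fin.sum_univ_castSucc]

/-- Drop the new rank-one term from the design matrix, which only enlarges the inverse form, and
expand the square. -/
lemma scoreForm_history_succ_le (hlam : 0 < lam) (A : ℕ → Ω → 𝒜) (R : ℕ → Ω → ℝ) (ω : Ω)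
    (ρ : EuclideanSpace ℝ (Fin d)) :
    scoreForm lam g φ (history A R (t + 1) ω) ρ ≤ scoreForm lam g φ (history A R t ω) ρ
      + 2 * (crossForm lam g φ (history A R t ω) ρ (A t ω)
        * (R t ω - glm g φ ρ (A t ω)))
      + (R t ω - glm g φ ρ (A t ω)) ^ 2 * featureForm lam φ (history A R t ω) (φ (A t ω)) := by
  have h1 : scoreForm lam g φ (history A R (t + 1) ω) ρ
      ≤ invForm (historyDesign lam φ (history A R t ω)) (score g φ (history A R (t + 1) ω) ρ) :=
    invForm_design_succ_le hlam _ _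
  rw [score_history_succ, invForm_add (historyDesign_posDef hlam _), invForm_smul,
    Matrix.mulVec_smul, dotProduct_smul, smul_eq_mul] at h1
  rw [mul_comm (crossForm lam g φ (history A R t ω) ρ (A t ω))]
  exact h1

lemma abs_two_mul_dotProduct_inv_le {W : Matrix (Fin d) (Fin d) ℝ} (hW : W.PosDef)
    (u v : Fin d → ℝ) : |2 * (u ⬝ᵥ (W⁻¹ *ᵥ v))| ≤ invForm W u + invForm W v := by
  have h1 := invForm_nonneg hW (u + v)
  have h2 := invForm_nonneg hW (u + (-1 : ℝ) • v)
  rw [invForm_add hW] at h1 h2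
  rw [invForm_smul, Matrix.mulVec_smul, dotProduct_smul, smul_eq_mul] at h2
  rw [abs_le]
  constructor <;> linarith

lemma abs_crossForm_le (hlam : 0 < lam) (hφ : ∀ b, ‖φ b‖ ≤ c₂) (h : Fin t → 𝒜 × ℝ)
    (ρ : EuclideanSpace ℝ (Fin d)) (b : 𝒜) :
    |crossForm lam g φ h ρ b| ≤ scoreForm lam g φ h ρ + c₂ ^ 2 / lam := by
  have h1 := abs_two_mul_dotProduct_inv_le (historyDesign_posDef (φ := φ) hlam h)
    (score g φ h ρ) (φ b).ofLp
  have h2 : invForm (historyDesign lam φ h) (φ b).ofLp ≤ c₂ ^ 2 / lam :=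
    featureForm_le hlam _ (hφ _)
  rw [abs_mul, abs_two] at h1
  have h4 := abs_nonneg (crossForm lam g φ h ρ b)
  unfold scoreForm
  unfold crossForm at h4 ⊢
  linarith

end History

/-! ### Measurability of the forms of a history. -/

section Measurability

variable {d t : ℕ} {𝒜 α : Type*} [MeasurableSpace 𝒜] [MeasurableSpace α] {lam : ℝ} {g : ℝ → ℝ}
  {φ : 𝒜 → EuclideanSpace ℝ (Fin d)}

lemma measurable_ofLp_comp {x : α → EuclideanSpace ℝ (Fin d)} (hx : Measurable x) :
    Measurable fun a => (x a).ofLp :=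
  (PiLp.continuous_ofLp 2 _).measurable.comp hx

lemma measurable_historyDesign (hφ : Measurable φ) {h : α → Fin t → 𝒜 × ℝ} (hh : Measurable h)
    (i j : Fin d) : Measurable fun a => historyDesign lam φ (h a) i j := by
  refine measurable_design lam (fun k => ?_) i j
  exact measurable_ofLp_comp (hφ.comp (measurable_fst.comp ((measurable_pi_apply k).comp hh)))

lemma measurable_glm (hg : Measurable g) (hφ : Measurable φ)
    {ρ : α → EuclideanSpace ℝ (Fin d)} (hρ : Measurable ρ) {b : α → 𝒜} (hb : Measurable b) :
    Measurable fun a => glm g φ (ρ a) (b a) :=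
  hg.comp ((hφ.comp hb).inner hρ)

lemma measurable_score (hg : Measurable g) (hφ : Measurable φ) {h : α → Fin t → 𝒜 × ℝ}
    (hh : Measurable h) {ρ : α → EuclideanSpace ℝ (Fin d)} (hρ : Measurable ρ) :
    Measurable fun a => score g φ (h a) (ρ a) := by
  have hk : ∀ k, Measurable fun a => h a k := fun k => (measurable_pi_apply k).comp hh
  unfold score
  refine Finset.measurable_sum _ fun k _ => ?_
  refine Measurable.smul (f := fun a => (h a k).2 - glm g φ (ρ a) (h a k).1) ?_ ?_
  · exact (measurable_snd.comp (hk k)).sub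
      (measurable_glm hg hφ hρ (measurable_fst.comp (hk k)))
  · exact measurable_ofLp_comp (hφ.comp (measurable_fst.comp (hk k)))

lemma measurable_scoreForm (hg : Measurable g) (hφ : Measurable φ) {h : α → Fin t → 𝒜 × ℝ}
    (hh : Measurable h) {ρ : α → EuclideanSpace ℝ (Fin d)} (hρ : Measurable ρ) :
    Measurable fun a => scoreForm lam g φ (h a) (ρ a) :=
  measurable_invForm (measurable_historyDesign hφ hh) (measurable_score hg hφ hh hρ)

lemma measurable_featureForm (hφ : Measurable φ) {h : α → Fin t → 𝒜 × ℝ}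
    (hh : Measurable h) {x : α → EuclideanSpace ℝ (Fin d)} (hx : Measurable x) :
    Measurable fun a => featureForm lam φ (h a) (x a) :=
  measurable_invForm (measurable_historyDesign hφ hh) (measurable_ofLp_comp hx)

lemma measurable_history {Ω : Type*} [MeasurableSpace Ω] {A : ℕ → Ω → 𝒜} {R : ℕ → Ω → ℝ}
    (hA : ∀ t, Measurable (A t)) (hR : ∀ t, Measurable (R t)) (t : ℕ) :
    Measurable (history A R t) :=
  measurable_pi_lambda _ fun k => (hA k).prodMk (hR k)

end Measurability

/-! ### The score at the true parameter as a martingale. -/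

lemma integral_mul_sub_condExp_eq_zero {Ω : Type*} {m mΩ : MeasurableSpace Ω} {μ : Measure Ω}
    [IsProbabilityMeasure μ] (hm : m ≤ mΩ) {Z R f : Ω → ℝ} (hZ : StronglyMeasurable[m] Z)
    (hR : Integrable R μ) {c : ℝ} (hc : ∀ᵐ ω ∂μ, ‖Z ω‖ ≤ c) (hf : μ[R | m] =ᵐ[μ] f) :
    ∫ ω, Z ω * (R ω - f ω) ∂μ = 0 := by
  have hZ' : AEStronglyMeasurable Z μ := (hZ.mono hm).aestronglyMeasurable
  have hfi : Integrable f μ := integrable_condExp.congr hf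
  have h1 : Integrable (fun ω => Z ω * R ω) μ := hR.bdd_mul hZ' hc
  have h2 : Integrable (fun ω => Z ω * f ω) μ := hfi.bdd_mul hZ' hc
  have h3 : ∫ ω, Z ω * R ω ∂μ = ∫ ω, Z ω * f ω ∂μ := by
    rw [← integral_condExp hm]
    refine integral_congr_ae ?_
    filter_upwards [condExp_stronglyMeasurable_mul_of_bound hm hZ hR c hc, hf] with ω h4 h5
    rw [← h5]
    exact h4
  simp only [mul_sub]
  rw [integral_sub h1 h2, h3, sub_self]

section Bandit

variable {d : ℕ} {𝒜 Ω : Type*} [MeasurableSpace 𝒜] [MeasurableSpace Ω] {lam c₂ C : ℝ} {g : ℝ → ℝ}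
  {φ : 𝒜 → EuclideanSpace ℝ (Fin d)} {μ : Measure Ω} [IsProbabilityMeasure μ]
  {θ : Ω → EuclideanSpace ℝ (Fin d)} {A : ℕ → Ω → 𝒜} {R : ℕ → Ω → ℝ} {π : Policy 𝒜}

lemma mean_mem_Icc (hπ : IsBanditProcess μ (glm g φ) π θ A R)
    (hR : ∀ t, ∀ᵐ ω ∂μ, R t ω ∈ Set.Icc 0 C) (t : ℕ) :
    ∀ᵐ ω ∂μ, glm g φ (θ ω) (A t ω) ∈ Set.Icc 0 C := by
  have hH := measurable_history hπ.measurable_action hπ.measurable_reward t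
  have hm : MeasurableSpace.comap (fun ω => (history A R t ω, θ ω, A t ω)) inferInstance
      ≤ (inferInstance : MeasurableSpace Ω) :=
    (hH.prodMk (hπ.measurable_param.prodMk (hπ.measurable_action t))).comap_le
  have h1 : 0 ≤ᵐ[μ] R t := (hR t).mono fun ω hω => hω.1
  have h2 : R t ≤ᵐ[μ] fun _ => C := (hR t).mono fun ω hω => hω.2
  have h3 := condExp_mono (m := MeasurableSpace.comap
    (fun ω => (history A R t ω, θ ω, A t ω)) inferInstance) (hπ.integrable_reward t)
    (integrable_const C) h2
  rw [condExp_const hm] at h3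
  filter_upwards [hπ.mean_reward t, h3, condExp_nonneg h1] with ω e h3 h4
  rw [← e]
  exact ⟨h4, h3⟩

/-- This crude bound, which doubles in each period, serves only for integrability and for the
bounded multiplier in `crossForm_residual`. -/
lemma exists_scoreForm_le (hlam : 0 < lam) (hφ : ∀ b, ‖φ b‖ ≤ c₂)
    (hπ : IsBanditProcess μ (glm g φ) π θ A R) (hR : ∀ t, ∀ᵐ ω ∂μ, R t ω ∈ Set.Icc 0 C) (t : ℕ) :
    ∃ b : ℝ, ∀ᵐ ω ∂μ, scoreForm lam g φ (history A R t ω) (θ ω) ≤ b := by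
  induction t with
  | zero => exact ⟨0, ae_of_all _ fun ω => by simp [scoreForm, score, invForm]⟩
  | succ t ih =>
    obtain ⟨b, hb⟩ := ih
    refine ⟨2 * b + 2 * (C ^ 2 * (c₂ ^ 2 / lam)), ?_⟩
    filter_upwards [hb, mean_mem_Icc hπ hR t, hR t] with ω hb h1 h2
    have hW := historyDesign_posDef (φ := φ) hlam (history A R t ω)
    have h3 : scoreForm lam g φ (history A R (t + 1) ω) (θ ω)
      ≤ invForm (historyDesign lam φ (history A R t ω))
        (score g φ (history A R (t + 1) ω) (θ ω)) := invForm_design_succ_le hlam _ _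
    have h4 := abs_two_mul_dotProduct_inv_le hW (score g φ (history A R t ω) (θ ω))
      ((R t ω - glm g φ (θ ω) (A t ω)) • (φ (A t ω)).ofLp)
    rw [score_history_succ, invForm_add hW] at h3
    have h5 : invForm (historyDesign lam φ (history A R t ω))
        ((R t ω - glm g φ (θ ω) (A t ω)) • (φ (A t ω)).ofLp) ≤ C ^ 2 * (c₂ ^ 2 / lam) := by
      rw [invForm_smul]
      refine mul_le_mul ?_ (featureForm_le hlam _ (hφ _)) (invForm_nonneg hW _) (sq_nonneg _)
      exact sq_le_sq' (by linarith [h1.2, h2.1]) (by linarith [h1.1, h2.2])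
    have h6 : invForm (historyDesign lam φ (history A R t ω))
      (score g φ (history A R t ω) (θ ω)) ≤ b := hb
    have h7 := (abs_le.1 h4).2
    linarith

lemma integrable_scoreForm (hlam : 0 < lam) (hg : Measurable g) (hφm : Measurable φ)
    (hφ : ∀ b, ‖φ b‖ ≤ c₂) (hπ : IsBanditProcess μ (glm g φ) π θ A R)
    (hR : ∀ t, ∀ᵐ ω ∂μ, R t ω ∈ Set.Icc 0 C) (t : ℕ) :
    Integrable (fun ω => scoreForm lam g φ (history A R t ω) (θ ω)) μ := by
  obtain ⟨b, hb⟩ := exists_scoreForm_le hlam hφ hπ hR t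
  refine Integrable.of_bound (C := b) (measurable_scoreForm hg hφm
    (measurable_history hπ.measurable_action hπ.measurable_reward t)
    hπ.measurable_param).aestronglyMeasurable ?_
  filter_upwards [hb] with ω h
  rwa [Real.norm_of_nonneg (scoreForm_nonneg hlam _ _)]

lemma integrable_featureForm (hlam : 0 < lam) (hφm : Measurable φ)
    (hφ : ∀ b, ‖φ b‖ ≤ c₂) (hA : ∀ t, Measurable (A t)) (hR : ∀ t, Measurable (R t)) (t : ℕ) :
    Integrable (fun ω => featureForm lam φ (history A R t ω) (φ (A t ω))) μ := by
  refine Integrable.of_bound (C := c₂ ^ 2 / lam) (measurable_featureForm hφm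
    (measurable_history hA hR t) (hφm.comp (hA t))).aestronglyMeasurable (ae_of_all _ fun ω => ?_)
  rw [Real.norm_of_nonneg (featureForm_nonneg hlam _ _)]
  exact featureForm_le hlam _ (hφ _)

lemma measurable_crossForm {α : Type*} [MeasurableSpace α] {t : ℕ} (hg : Measurable g)
    (hφm : Measurable φ) {h : α → Fin t → 𝒜 × ℝ} (hh : Measurable h)
    {ρ : α → EuclideanSpace ℝ (Fin d)} (hρ : Measurable ρ) {b : α → 𝒜} (hb : Measurable b) :
    Measurable fun a => crossForm lam g φ (h a) (ρ a) (b a) :=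
  measurable_dotProduct (measurable_score hg hφm hh hρ)
    (measurable_inv_mulVec (measurable_historyDesign hφm hh) (measurable_ofLp_comp (hφm.comp hb)))

/-- The factor `crossForm` is a function of `(H_t, θ, A_t)`, given which the residual has mean zero.
-/
lemma crossForm_residual (hlam : 0 < lam) (hg : Measurable g)
    (hφm : Measurable φ) (hφ : ∀ b, ‖φ b‖ ≤ c₂) (hπ : IsBanditProcess μ (glm g φ) π θ A R)
    (hR : ∀ t, ∀ᵐ ω ∂μ, R t ω ∈ Set.Icc 0 C) (t : ℕ) :
    Integrable (fun ω => crossForm lam g φ (history A R t ω) (θ ω) (A t ω)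
      * (R t ω - glm g φ (θ ω) (A t ω))) μ ∧
    ∫ ω, crossForm lam g φ (history A R t ω) (θ ω) (A t ω)
      * (R t ω - glm g φ (θ ω) (A t ω)) ∂μ = 0 := by
  have hH := measurable_history hπ.measurable_action hπ.measurable_reward t
  obtain ⟨b, hb⟩ := exists_scoreForm_le hlam hφ hπ hR t
  have hJ := hH.prodMk (hπ.measurable_param.prodMk (hπ.measurable_action t))
  have hF : Measurable fun p : (Fin t → 𝒜 × ℝ) × EuclideanSpace ℝ (Fin d) × 𝒜 =>
      crossForm lam g φ p.1 p.2.1 p.2.2 :=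
    measurable_crossForm hg hφm measurable_fst (measurable_fst.comp measurable_snd)
      (measurable_snd.comp measurable_snd)
  have hZm : StronglyMeasurable[MeasurableSpace.comap
      (fun ω => (history A R t ω, θ ω, A t ω)) inferInstance]
      fun ω => crossForm lam g φ (history A R t ω) (θ ω) (A t ω) :=
    (hF.comp (comap_measurable fun ω => (history A R t ω, θ ω, A t ω))).stronglyMeasurable
  have hZb : ∀ᵐ ω ∂μ, ‖crossForm lam g φ (history A R t ω) (θ ω) (A t ω)‖ ≤ b + c₂ ^ 2 / lam := by
    filter_upwards [hb] with ω hb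
    exact (abs_crossForm_le hlam hφ _ _ _).trans (by gcongr)
  have hfi : Integrable (fun ω => glm g φ (θ ω) (A t ω)) μ :=
    integrable_condExp.congr (hπ.mean_reward t)
  exact ⟨((hπ.integrable_reward t).sub hfi).bdd_mul
      (hZm.mono hJ.comap_le).aestronglyMeasurable hZb,
    integral_mul_sub_condExp_eq_zero hJ.comap_le hZm (hπ.integrable_reward t) hZb
      (hπ.mean_reward t)⟩

lemma integral_scoreForm_succ_le (hlam : 0 < lam) (hg : Measurable g)
    (hφm : Measurable φ) (hφ : ∀ b, ‖φ b‖ ≤ c₂) (hπ : IsBanditProcess μ (glm g φ) π θ A R)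
    (hR : ∀ t, ∀ᵐ ω ∂μ, R t ω ∈ Set.Icc 0 C) (t : ℕ) :
    ∫ ω, scoreForm lam g φ (history A R (t + 1) ω) (θ ω) ∂μ
      ≤ ∫ ω, scoreForm lam g φ (history A R t ω) (θ ω) ∂μ
        + C ^ 2 * ∫ ω, featureForm lam φ (history A R t ω) (φ (A t ω)) ∂μ := by
  obtain ⟨hcint, hcross⟩ := crossForm_residual hlam hg hφm hφ hπ hR t
  have hS := integrable_scoreForm hlam hg hφm hφ hπ hR
  have hX := integrable_featureForm (μ := μ) hlam hφm hφ hπ.measurable_action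
    hπ.measurable_reward t
  have h12 : Integrable (fun ω => scoreForm lam g φ (history A R t ω) (θ ω)
      + 2 * (crossForm lam g φ (history A R t ω) (θ ω) (A t ω)
        * (R t ω - glm g φ (θ ω) (A t ω)))) μ := (hS t).add (hcint.const_mul 2)
  have h3 := hX.const_mul (C ^ 2)
  calc ∫ ω, scoreForm lam g φ (history A R (t + 1) ω) (θ ω) ∂μ
      ≤ ∫ ω, ((scoreForm lam g φ (history A R t ω) (θ ω)
          + 2 * (crossForm lam g φ (history A R t ω) (θ ω) (A t ω)
            * (R t ω - glm g φ (θ ω) (A t ω))))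
          + C ^ 2 * featureForm lam φ (history A R t ω) (φ (A t ω))) ∂μ := by
        refine integral_mono_ae (hS (t + 1)) (h12.add h3) ?_
        filter_upwards [mean_mem_Icc hπ hR t, hR t] with ω h1 h2
        refine (scoreForm_history_succ_le hlam A R ω (θ ω)).trans ?_
        refine add_le_add le_rfl (mul_le_mul_of_nonneg_right ?_ (featureForm_nonneg hlam _ _))
        -- Reward and conditional mean both lie in `[0, C]`, so the residual is at most `C` in
        -- absolute value.
        exact sq_le_sq' (by linarith [h1.2, h2.1]) (by linarith [h1.1, h2.2])
    _ = _ := by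
        rw [integral_add h12 h3, integral_add (hS t) (hcint.const_mul 2), integral_const_mul,
          integral_const_mul, hcross]
        ring

lemma integral_scoreForm_le_sum (hlam : 0 < lam) (hg : Measurable g)
    (hφm : Measurable φ) (hφ : ∀ b, ‖φ b‖ ≤ c₂) (hπ : IsBanditProcess μ (glm g φ) π θ A R)
    (hR : ∀ t, ∀ᵐ ω ∂μ, R t ω ∈ Set.Icc 0 C) (t : ℕ) :
    ∫ ω, scoreForm lam g φ (history A R t ω) (θ ω) ∂μ
      ≤ C ^ 2 * ∑ k ∈ Finset.range t,
          ∫ ω, featureForm lam φ (history A R k ω) (φ (A k ω)) ∂μ := by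
  induction t with
  | zero => simp [scoreForm, score, invForm]
  | succ t ih =>
    rw [Finset.sum_range_succ, mul_add]
    exact (integral_scoreForm_succ_le hlam hg hφm hφ hπ hR t).trans (by gcongr)

lemma sum_integral_featureForm_le (hlam : 0 < lam) (hφm : Measurable φ)
    (hφ : ∀ b, ‖φ b‖ ≤ c₂) (hA : ∀ t, Measurable (A t)) (hR : ∀ t, Measurable (R t)) (T : ℕ) :
    ∑ k ∈ Finset.range T, ∫ ω, featureForm lam φ (history A R k ω) (φ (A k ω)) ∂μ
      ≤ (1 + c₂ ^ 2 / lam) * (d * Real.log (1 + T * (c₂ ^ 2 / lam))) := by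
  rw [← integral_finsetSum _ fun k _ => integrable_featureForm hlam hφm hφ hA hR k]
  have h : ∀ ω, ∑ k ∈ Finset.range T, featureForm lam φ (history A R k ω) (φ (A k ω))
      ≤ (1 + c₂ ^ 2 / lam) * (d * Real.log (1 + T * (c₂ ^ 2 / lam))) := fun ω =>
    sum_invForm_design_le hlam (fun k => (φ (A k ω)).ofLp) (fun k => by
      rw [ofLp_dotProduct_self]
      exact pow_le_pow_left₀ (norm_nonneg _) (hφ _) 2) T
  calc _ ≤ ∫ _ω, (1 + c₂ ^ 2 / lam) * (d * Real.log (1 + T * (c₂ ^ 2 / lam))) ∂μ :=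
        integral_mono (integrable_finsetSum _ fun k _ =>
          integrable_featureForm hlam hφm hφ hA hR k) (integrable_const _) h
    _ = _ := by simp

end Bandit

/-! ### From slopes of the link function to differences of mean rewards. -/

section Slopes

variable {d t : ℕ} {𝒜 : Type*} {g : ℝ → ℝ} {φ : 𝒜 → EuclideanSpace ℝ (Fin d)}
  {Θ : Set (EuclideanSpace ℝ (Fin d))} {c₁ c₂ lam : ℝ}

/-- An infimum over a set unbounded below would have the default value `0`. -/
lemma bddBelow_slopes (h : 0 < sInf (slopes g φ Θ)) : BddBelow (slopes g φ Θ) := by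
  by_contra hb
  rw [Real.sInf_of_not_bddBelow hb] at h
  exact lt_irrefl _ h

lemma bddAbove_slopes (hg : ContDiff ℝ 1 g) (hΘ : ∀ ρ ∈ Θ, ‖ρ‖ ≤ c₁) (hφ : ∀ b, ‖φ b‖ ≤ c₂) :
    BddAbove (slopes g φ Θ) := by
  have hcont : Continuous (deriv g) := hg.continuous_deriv le_rfl
  have hK : IsCompact (deriv g '' Metric.closedBall (0 : ℝ) (c₂ * c₁)) :=
    (isCompact_closedBall _ _).image hcont
  refine hK.bddAbove.mono ?_
  rintro s ⟨ρ, hρ, b, rfl⟩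
  refine ⟨_, ?_, rfl⟩
  have h1 : ‖ρ‖ ≤ c₁ := by
    have : convexHull ℝ Θ ⊆ Metric.closedBall 0 c₁ :=
      convexHull_min (fun ρ hρ => by simpa using hΘ ρ hρ) (convex_closedBall _ _)
    simpa using this hρ
  rw [mem_closedBall_zero_iff]
  exact (norm_inner_le_norm _ _).trans
    (mul_le_mul (hφ b) h1 (norm_nonneg _) ((norm_nonneg _).trans (hφ b)))

/-- The bounds extend to closures by continuity. Closures are used because `Θ` and the range of `φ`
need not be measurable. -/
lemma deriv_mem_Icc_of_mem_closure (hg : ContDiff ℝ 1 g) (hΘ : ∀ ρ ∈ Θ, ‖ρ‖ ≤ c₁)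
    (hφ : ∀ b, ‖φ b‖ ≤ c₂) (hl : 0 < sInf (slopes g φ Θ)) {ρ x : EuclideanSpace ℝ (Fin d)}
    (hρ : ρ ∈ closure (convexHull ℝ Θ)) (hx : x ∈ closure (Set.range φ)) :
    deriv g (inner ℝ x ρ) ∈ Set.Icc (sInf (slopes g φ Θ)) (sSup (slopes g φ Θ)) := by
  have hcont : Continuous (deriv g) := hg.continuous_deriv le_rfl
  have hclosed : IsClosed {p : EuclideanSpace ℝ (Fin d) × EuclideanSpace ℝ (Fin d) |
      deriv g (inner ℝ p.2 p.1) ∈ Set.Icc (sInf (slopes g φ Θ)) (sSup (slopes g φ Θ))} :=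
    isClosed_Icc.preimage (hcont.comp (continuous_snd.inner continuous_fst))
  have hsub : convexHull ℝ Θ ×ˢ Set.range φ ⊆
      {p : EuclideanSpace ℝ (Fin d) × EuclideanSpace ℝ (Fin d) |
      deriv g (inner ℝ p.2 p.1) ∈ Set.Icc (sInf (slopes g φ Θ)) (sSup (slopes g φ Θ))} := by
    rintro ⟨ρ, x⟩ ⟨hρ, b, rfl⟩
    have hmem : deriv g (inner ℝ (φ b) ρ) ∈ slopes g φ Θ := ⟨ρ, hρ, b, rfl⟩
    exact ⟨csInf_le (bddBelow_slopes hl) hmem, le_csSup (bddAbove_slopes hg hΘ hφ) hmem⟩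
  have h := closure_minimal hsub hclosed
  rw [closure_prod_eq] at h
  exact h (Set.mk_mem_prod hρ hx)

/-- Mean value theorem along the segment from `ρ` to `ρ'`, which stays in the closed convex hull. -/
lemma exists_slope (hg : ContDiff ℝ 1 g) (hΘ : ∀ ρ ∈ Θ, ‖ρ‖ ≤ c₁)
    (hφ : ∀ b, ‖φ b‖ ≤ c₂) (hl : 0 < sInf (slopes g φ Θ)) {ρ ρ' x : EuclideanSpace ℝ (Fin d)}
    (hρ : ρ ∈ closure (convexHull ℝ Θ)) (hρ' : ρ' ∈ closure (convexHull ℝ Θ))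
    (hx : x ∈ closure (Set.range φ)) :
    ∃ c ∈ Set.Icc (sInf (slopes g φ Θ)) (sSup (slopes g φ Θ)),
      g (inner ℝ x ρ') - g (inner ℝ x ρ) = c * (x.ofLp ⬝ᵥ (ρ' - ρ).ofLp) := by
  have hd : Differentiable ℝ g := hg.differentiable one_ne_zero
  have hderiv : ∀ s : ℝ, HasDerivAt (fun s => g (inner ℝ x ρ + s * inner ℝ x (ρ' - ρ)))
      (deriv g (inner ℝ x ρ + s * inner ℝ x (ρ' - ρ)) * inner ℝ x (ρ' - ρ)) s := fun s => by
    have h1 : HasDerivAt (fun s : ℝ => inner ℝ x ρ + s * inner ℝ x (ρ' - ρ))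
        (inner ℝ x (ρ' - ρ)) s := by
      simpa using ((hasDerivAt_id s).mul_const (inner ℝ x (ρ' - ρ))).const_add (inner ℝ x ρ)
    exact (hd _).hasDerivAt.comp s h1
  obtain ⟨s, hs, he⟩ := exists_hasDerivAt_eq_slope
    (fun s => g (inner ℝ x ρ + s * inner ℝ x (ρ' - ρ))) _ (zero_lt_one' ℝ)
    (fun s _ => (hderiv s).continuousAt.continuousWithinAt) (fun s _ => hderiv s)
  have hseg : ρ + s • (ρ' - ρ) ∈ closure (convexHull ℝ Θ) :=
    (convex_convexHull ℝ Θ).closure.add_smul_sub_mem hρ hρ' ⟨hs.1.le, hs.2.le⟩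
  refine ⟨_, deriv_mem_Icc_of_mem_closure hg hΘ hφ hl hseg hx, ?_⟩
  rw [inner_add_right, inner_smul_right, ← inner_eq_dotProduct, he, inner_sub_right]
  simp

/-- With `Δ = ρ' - ρ`, the scores differ by `y = ∑ e k ⟨φ k, Δ⟩ φ k` with slopes `e k ≥ l`, so `Δ ⬝ᵥ
y` dominates a multiple of the squared `W`-norm `q` of `Δ`. One use of Young's inequality bounds `q`
by the scores, a second one bounds `x ⬝ᵥ Δ` by `q` and the feature form. The factor `L / l` is the
slope ratio. -/
lemma glm_sub_le (hg : ContDiff ℝ 1 g) (hΘ : ∀ ρ ∈ Θ, ‖ρ‖ ≤ c₁) (hφ : ∀ b, ‖φ b‖ ≤ c₂)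
    (hl : 0 < sInf (slopes g φ Θ)) (hlam : 0 < lam) {h : Fin t → 𝒜 × ℝ}
    (hh : ∀ u : Fin d → ℝ, lam * (u ⬝ᵥ u) ≤ ∑ k, ((φ (h k).1).ofLp ⬝ᵥ u) ^ 2)
    {ρ ρ' x : EuclideanSpace ℝ (Fin d)}
    (hρ : ρ ∈ closure (convexHull ℝ Θ)) (hρ' : ρ' ∈ closure (convexHull ℝ Θ))
    (hx : x ∈ closure (Set.range φ)) {η : ℝ} (hη : 0 < η) :
    g (inner ℝ x ρ') - g (inner ℝ x ρ) ≤ slopeRatio g φ Θ * (η / 2 * featureForm lam φ h x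
      + 4 / η * (scoreForm lam g φ h ρ + scoreForm lam g φ h ρ')) := by
  have hW := historyDesign_posDef (φ := φ) hlam h
  unfold slopeRatio
  set l := sInf (slopes g φ Θ)
  set L := sSup (slopes g φ Θ)
  obtain ⟨c, hc, hcx⟩ := exists_slope hg hΘ hφ hl hρ hρ' hx
  choose e he hex using fun k => exists_slope hg hΘ hφ hl hρ hρ'
    (subset_closure (Set.mem_range_self (h k).1))
  set Δ : Fin d → ℝ := (ρ' - ρ).ofLp
  set q := Δ ⬝ᵥ (historyDesign lam φ h *ᵥ Δ) with hq
  set y := score g φ h ρ - score g φ h ρ' with hy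
  have hL : 0 < L := hl.trans_le (hc.1.trans hc.2)
  have hq0 : 0 ≤ q := form_nonneg hW Δ
  -- The initial design pays for the regularizer `lam • 1`.
  have hqle : q ≤ 2 * ∑ k, ((φ (h k).1).ofLp ⬝ᵥ Δ) ^ 2 := by
    rw [hq, historyDesign, design_form]
    linarith [hh Δ]
  have hyΔ : Δ ⬝ᵥ y = ∑ k, e k * ((φ (h k).1).ofLp ⬝ᵥ Δ) ^ 2 := by
    rw [hy, score, score, ← Finset.sum_sub_distrib, dotProduct_sum]
    refine Finset.sum_congr rfl fun k _ => ?_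
    rw [← sub_smul, dotProduct_smul, smul_eq_mul, dotProduct_comm Δ]
    have : (h k).2 - glm g φ ρ (h k).1 - ((h k).2 - glm g φ ρ' (h k).1)
        = e k * ((φ (h k).1).ofLp ⬝ᵥ Δ) := by
      rw [← hex k]
      simp [glm]
    rw [this]
    ring
  have hlow : l * q ≤ 2 * (Δ ⬝ᵥ y) := by
    have : l * ∑ k, ((φ (h k).1).ofLp ⬝ᵥ Δ) ^ 2 ≤ Δ ⬝ᵥ y := by
      rw [hyΔ, Finset.mul_sum]
      exact Finset.sum_le_sum fun k _ => mul_le_mul_of_nonneg_right (he k).1 (sq_nonneg _)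
    nlinarith
  have hyY : invForm (historyDesign lam φ h) y
      ≤ 2 * (scoreForm lam g φ h ρ + scoreForm lam g φ h ρ') := by
    rw [mul_add]
    exact invForm_sub_le hW _ _
  -- The weight `l / 2` lets half of `l * q` in `hlow` be absorbed.
  have hyoung := young_form hW Δ y (half_pos hl)
  have hqY : q ≤ 8 / l ^ 2 * (scoreForm lam g φ h ρ + scoreForm lam g φ h ρ') := by
    have h1 : l / 2 * q ≤ (l / 2)⁻¹ * invForm (historyDesign lam φ h) y := by linarith
    have h2 : q ≤ (l / 2)⁻¹ * ((l / 2)⁻¹ * invForm (historyDesign lam φ h) y) := by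
      rwa [← inv_mul_le_iff₀ (by positivity), inv_inv]
    refine h2.trans ?_
    calc (l / 2)⁻¹ * ((l / 2)⁻¹ * invForm (historyDesign lam φ h) y)
        ≤ (l / 2)⁻¹ * ((l / 2)⁻¹ * (2 * (scoreForm lam g φ h ρ + scoreForm lam g φ h ρ'))) := by
          gcongr
      _ = _ := by
          field_simp
          ring
  have hfeat := young_form hW Δ x.ofLp (div_pos hl hη)
  have hF : 0 ≤ featureForm lam φ h x := featureForm_nonneg hlam h x
  have hS : 0 ≤ scoreForm lam g φ h ρ + scoreForm lam g φ h ρ' :=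
    add_nonneg (scoreForm_nonneg hlam h ρ) (scoreForm_nonneg hlam h ρ')
  rw [hcx]
  -- Replacing `c` by `L` is legitimate only for a nonnegative factor; otherwise the left side is
  -- already nonpositive.
  rcases le_or_gt 0 (x.ofLp ⬝ᵥ Δ) with hpos | hneg
  · calc c * (x.ofLp ⬝ᵥ Δ) ≤ L * (x.ofLp ⬝ᵥ Δ) := by gcongr; exact hc.2
      _ ≤ L * ((l / η * (8 / l ^ 2 * (scoreForm lam g φ h ρ + scoreForm lam g φ h ρ'))
            + (l / η)⁻¹ * featureForm lam φ h x) / 2) := by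
          gcongr
          rw [dotProduct_comm]
          have : l / η * q ≤ l / η *
            (8 / l ^ 2 * (scoreForm lam g φ h ρ + scoreForm lam g φ h ρ')) := by gcongr
          unfold featureForm
          linarith
      _ = _ := by
          field_simp
          ring
  · refine (mul_nonpos_of_nonneg_of_nonpos (hl.le.trans hc.1) hneg.le).trans ?_
    positivity

end Slopes

/-! ### Regret of a single period. -/

lemma lam_mul_le_of_design {d t : ℕ} {lam : ℝ} (w : Fin d → Fin d → ℝ)
    (hw : (∑ i, Matrix.vecMulVec (w i) (w i) - lam • (1 : Matrix (Fin d) (Fin d) ℝ)).PosSemidef)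
    (hdt : d ≤ t) (v : Fin t → Fin d → ℝ) (hv : ∀ i : Fin d, v (Fin.castLE hdt i) = w i)
    (u : Fin d → ℝ) : lam * (u ⬝ᵥ u) ≤ ∑ k, (v k ⬝ᵥ u) ^ 2 := by
  have h1 := hw.dotProduct_mulVec_nonneg u
  simp only [star_trivial, Matrix.sub_mulVec, dotProduct_sub, Matrix.sum_mulVec, dotProduct_sum,
    vecMulVec_form, Matrix.smul_mulVec, Matrix.one_mulVec, dotProduct_smul, smul_eq_mul] at h1
  have h2 : ∑ i, (w i ⬝ᵥ u) ^ 2 ≤ ∑ k, (v k ⬝ᵥ u) ^ 2 := by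
    calc ∑ i, (w i ⬝ᵥ u) ^ 2 = ∑ k ∈ Finset.univ.map (Fin.castLEEmb hdt), (v k ⬝ᵥ u) ^ 2 := by
          rw [Finset.sum_map]
          exact Finset.sum_congr rfl fun i _ => by rw [← hv i]; rfl
      _ ≤ _ := Finset.sum_le_sum_of_subset_of_nonneg (Finset.subset_univ _)
          fun _ _ _ => sq_nonneg _
  linarith

lemma integral_comp_eq_of_map_eq {Ψ S γ : Type*} [MeasurableSpace Ψ] [MeasurableSpace S]
    [MeasurableSpace γ] {ν : Measure Ψ} {κ : Measure S} {p : Ψ → γ} {q : S → γ}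
    (hp : Measurable p) (hq : Measurable q) (h : ν.map p = κ.map q) {F : γ → ℝ}
    (hF : Measurable F) : ∫ x, F (p x) ∂ν = ∫ x, F (q x) ∂κ := by
  rw [← integral_map hp.aemeasurable hF.aestronglyMeasurable, h,
    integral_map hq.aemeasurable hF.aestronglyMeasurable]

lemma integrable_comp_of_map_eq {Ψ S γ : Type*} [MeasurableSpace Ψ] [MeasurableSpace S]
    [MeasurableSpace γ] {ν : Measure Ψ} {κ : Measure S} {p : Ψ → γ} {q : S → γ}
    (hp : Measurable p) (hq : Measurable q) (h : ν.map p = κ.map q) {F : γ → ℝ}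
    (hF : Measurable F) (hi : Integrable (fun x => F (q x)) κ) :
    Integrable (fun x => F (p x)) ν := by
  refine (integrable_map_measure hF.aestronglyMeasurable hp.aemeasurable).1 ?_
  rw [h]
  exact (integrable_map_measure hF.aestronglyMeasurable hq.aemeasurable).2 hi

section Bandit

variable {d : ℕ} {𝒜 Ω : Type*} [MeasurableSpace 𝒜] [MeasurableSpace Ω] {lam c₁ c₂ C : ℝ}
  {g : ℝ → ℝ} {φ : 𝒜 → EuclideanSpace ℝ (Fin d)} {μ : Measure Ω}
  {Θ : Set (EuclideanSpace ℝ (Fin d))}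
  {θ : Ω → EuclideanSpace ℝ (Fin d)} {A Aopt : ℕ → Ω → 𝒜} {R : ℕ → Ω → ℝ} {π : Policy 𝒜}
  {a : Fin d → 𝒜} {f : EuclideanSpace ℝ (Fin d) → 𝒜 → ℝ}

/-- Passing from actions to features puts the coupling on a Euclidean space, which is standard
Borel, while `𝒜` is an arbitrary measurable space. -/
lemma feature_law (hφm : Measurable φ) (hπ : IsBanditProcess μ f π θ A R)
    (hps : IsInitializedPosteriorSampling μ A R Aopt a π) {t : ℕ} (ht : d ≤ t)
    (B : Set (EuclideanSpace ℝ (Fin d))) (hB : MeasurableSet B) :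
    μ⟦(fun ω => φ (A t ω)) ⁻¹' B |
        MeasurableSpace.comap (fun ω => (history A R t ω, θ ω)) inferInstance⟧
      =ᵐ[μ] μ⟦(fun ω => φ (Aopt t ω)) ⁻¹' B |
        MeasurableSpace.comap (history A R t) inferInstance⟧ :=
  (hπ.action_law t _ (hφm hB)).trans (hps.posterior t ht _ (hφm hB))

lemma periodRegret_ae_eq (hopt : IsOptimalAction μ f θ Aopt) (t : ℕ) :
    periodRegret f θ A t =ᵐ[μ] fun ω => f (θ ω) (Aopt t ω) - f (θ ω) (A t ω) := by
  filter_upwards [hopt.isMax t] with ω h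
  have : Nonempty 𝒜 := ⟨A t ω⟩
  unfold periodRegret
  congr 1
  refine le_antisymm (ciSup_le h) (le_ciSup (f := fun b => f (θ ω) b) ⟨f (θ ω) (Aopt t ω), ?_⟩ _)
  rintro _ ⟨b, rfl⟩
  exact h b

lemma integrable_glm_action (hπ : IsBanditProcess μ (glm g φ) π θ A R) (t : ℕ) :
    Integrable (fun ω => glm g φ (θ ω) (A t ω)) μ :=
  integrable_condExp.congr (hπ.mean_reward t)

variable [IsProbabilityMeasure μ]

/-- Only features are identified, since singletons of `𝒜` need not be measurable. -/
lemma feature_initial_action (hφm : Measurable φ) (hπ : IsBanditProcess μ f π θ A R)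
    (hps : IsInitializedPosteriorSampling μ A R Aopt a π) :
    ∀ᵐ ω ∂μ, ∀ i : Fin d, φ (A i ω) = φ (a i) := by
  rw [ae_all_iff]
  intro i
  have hB : MeasurableSet (φ ⁻¹' {φ (a i)}) := hφm (measurableSet_singleton _)
  have hpre : MeasurableSet (A i ⁻¹' (φ ⁻¹' {φ (a i)})) := hπ.measurable_action i hB
  have h1 := hπ.action_law i _ hB
  have hH := measurable_history hπ.measurable_action hπ.measurable_reward i
  have h2 : ∫ ω, (A i ⁻¹' (φ ⁻¹' {φ (a i)})).indicator (fun _ => (1 : ℝ)) ω ∂μ = 1 := by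
    rw [← integral_condExp (hH.prodMk hπ.measurable_param).comap_le, integral_congr_ae h1]
    have : ∀ ω, (π.kernel i (history A R i ω)).real (φ ⁻¹' {φ (a i)}) = 1 := fun ω => by
      rw [hps.initial i i.2, measureReal_def, Measure.dirac_apply' _ hB]
      simp
    simp [this]
  rw [integral_indicator_const _ hpre, smul_eq_mul, mul_one] at h2
  have h3 : μ (A i ⁻¹' (φ ⁻¹' {φ (a i)})) = 1 := by
    rw [measureReal_def] at h2
    exact (ENNReal.toReal_eq_one_iff _).1 h2
  exact (prob_compl_eq_zero_iff hpre).2 h3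

/-- The rewards bound `f_θ` only at played actions. In period `d`, the first with posterior
sampling, `ae_mem_of_copy` transfers the bound to the optimal action; the optimal value is the same
in all periods. -/
lemma optimal_mem_Icc (hg : Continuous g) (hφm : Measurable φ)
    (hπ : IsBanditProcess μ (glm g φ) π θ A R) (hR : ∀ t, ∀ᵐ ω ∂μ, R t ω ∈ Set.Icc 0 C)
    (hopt : IsOptimalAction μ (glm g φ) θ Aopt)
    (hps : IsInitializedPosteriorSampling μ A R Aopt a π) (t : ℕ) :
    ∀ᵐ ω ∂μ, glm g φ (θ ω) (Aopt t ω) ∈ Set.Icc 0 C := by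
  have hclosed : IsClosed {p : EuclideanSpace ℝ (Fin d) × EuclideanSpace ℝ (Fin d) |
      g (inner ℝ p.2 p.1) ∈ Set.Icc 0 C} :=
    isClosed_Icc.preimage (hg.comp (continuous_snd.inner continuous_fst))
  have h := ae_mem_of_copy
    (measurable_history hπ.measurable_action hπ.measurable_reward d) hπ.measurable_param
    (hφm.comp (hπ.measurable_action d)) (hφm.comp (hopt.measurable_action d))
    (feature_law hφm hπ hps le_rfl) hclosed (mean_mem_Icc hπ hR d)
  filter_upwards [h, hopt.isMax t, hopt.isMax d] with ω h h1 h2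
  rw [le_antisymm (h2 _) (h1 _)]
  exact h

lemma integrable_glm_optimal (hg : Continuous g) (hφm : Measurable φ)
    (hπ : IsBanditProcess μ (glm g φ) π θ A R) (hR : ∀ t, ∀ᵐ ω ∂μ, R t ω ∈ Set.Icc 0 C)
    (hopt : IsOptimalAction μ (glm g φ) θ Aopt)
    (hps : IsInitializedPosteriorSampling μ A R Aopt a π) (t : ℕ) :
    Integrable (fun ω => glm g φ (θ ω) (Aopt t ω)) μ := by
  refine Integrable.of_bound (C := C) (measurable_glm hg.measurable hφm hπ.measurable_param
    (hopt.measurable_action t)).aestronglyMeasurable ?_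
  filter_upwards [optimal_mem_Icc hg hφm hπ hR hopt hps t] with ω h
  rw [Real.norm_of_nonneg h.1]
  exact h.2

lemma integral_periodRegret_le_of_bounded (hg : Continuous g) (hφm : Measurable φ)
    (hπ : IsBanditProcess μ (glm g φ) π θ A R) (hR : ∀ t, ∀ᵐ ω ∂μ, R t ω ∈ Set.Icc 0 C)
    (hopt : IsOptimalAction μ (glm g φ) θ Aopt)
    (hps : IsInitializedPosteriorSampling μ A R Aopt a π) (t : ℕ) :
    ∫ ω, periodRegret (glm g φ) θ A t ω ∂μ ≤ C := by
  rw [integral_congr_ae (periodRegret_ae_eq hopt t)]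
  calc _ ≤ ∫ _ω, C ∂μ := by
        refine integral_mono_ae ((integrable_glm_optimal hg hφm hπ hR hopt hps t).sub
          (integrable_glm_action hπ t)) (integrable_const C) ?_
        filter_upwards [optimal_mem_Icc hg hφm hπ hR hopt hps t, mean_mem_Icc hπ hR t] with ω h1 h2
        linarith [h1.2, h2.1]
    _ = C := by simp

/-- Under the coupling `Ψ`, the optimal reward is read off the second draw (`p2`), the earned reward
off the first parameter and the second feature (`p3`). Both scores have the same expectation, whence
`8 = 4 + 4`. -/
lemma integral_periodRegret_le (hg : ContDiff ℝ 1 g) (hφm : Measurable φ)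
    (hΘ : ∀ ρ ∈ Θ, ‖ρ‖ ≤ c₁) (hφ : ∀ b, ‖φ b‖ ≤ c₂) (hl : 0 < sInf (slopes g φ Θ))
    (hlam : 0 < lam)
    (hdesign : (∑ i, Matrix.vecMulVec (φ (a i)).ofLp (φ (a i)).ofLp
      - lam • (1 : Matrix (Fin d) (Fin d) ℝ)).PosSemidef)
    (hθ : ∀ᵐ ω ∂μ, θ ω ∈ Θ)
    (hπ : IsBanditProcess μ (glm g φ) π θ A R) (hR : ∀ t, ∀ᵐ ω ∂μ, R t ω ∈ Set.Icc 0 C)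
    (hopt : IsOptimalAction μ (glm g φ) θ Aopt)
    (hps : IsInitializedPosteriorSampling μ A R Aopt a π) {t : ℕ} (ht : d ≤ t)
    {η : ℝ} (hη : 0 < η) :
    ∫ ω, periodRegret (glm g φ) θ A t ω ∂μ
      ≤ slopeRatio g φ Θ * (η / 2 * ∫ ω, featureForm lam φ (history A R t ω) (φ (A t ω)) ∂μ
        + 8 / η * ∫ ω, scoreForm lam g φ (history A R t ω) (θ ω) ∂μ) := by
  have hgm : Measurable g := hg.continuous.measurable
  have hH := measurable_history hπ.measurable_action hπ.measurable_reward t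
  have hX : Measurable fun ω => φ (A t ω) := hφm.comp (hπ.measurable_action t)
  have hY : Measurable fun ω => φ (Aopt t ω) := hφm.comp (hopt.measurable_action t)
  obtain ⟨Ψ, hΨ, m1, m2, m3⟩ := exists_conditional_copy hH hπ.measurable_param hX hY
    (feature_law hφm hπ hps ht)
  have hHY := hH.prodMk (hπ.measurable_param.prodMk hY)
  have hHX := hH.prodMk (hπ.measurable_param.prodMk hX)
  rw [integral_congr_ae (periodRegret_ae_eq hopt t),
    integral_sub (integrable_glm_optimal hg.continuous hφm hπ hR hopt hps t)
      (integrable_glm_action hπ t)]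
  let E := EuclideanSpace ℝ (Fin d)
  let V : (Fin t → 𝒜 × ℝ) × E × E → ℝ := fun p => g (inner ℝ p.2.2 p.2.1)
  let S : (Fin t → 𝒜 × ℝ) × E × E → ℝ := fun p => scoreForm lam g φ p.1 p.2.1
  let F : (Fin t → 𝒜 × ℝ) × E × E → ℝ := fun p => featureForm lam φ p.1 p.2.2
  have hV : Measurable V := hgm.comp (Measurable.inner (by fun_prop) (by fun_prop))
  have hS : Measurable S := measurable_scoreForm hgm hφm measurable_fst (by fun_prop)
  have hF : Measurable F := measurable_featureForm hφm measurable_fst (by fun_prop)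
  let p1 : (Fin t → 𝒜 × ℝ) × (E × E) × (E × E) → (Fin t → 𝒜 × ℝ) × E × E := fun q => (q.1, q.2.1)
  let p2 : (Fin t → 𝒜 × ℝ) × (E × E) × (E × E) → (Fin t → 𝒜 × ℝ) × E × E := fun q => (q.1, q.2.2)
  let p3 : (Fin t → 𝒜 × ℝ) × (E × E) × (E × E) → (Fin t → 𝒜 × ℝ) × E × E :=
    fun q => (q.1, q.2.1.1, q.2.2.2)
  have hp1 : Measurable p1 := by fun_prop
  have hp2 : Measurable p2 := by fun_prop
  have hp3 : Measurable p3 := by fun_prop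
  have hSi := integrable_scoreForm hlam hgm hφm hφ hπ hR t
  have hFi := integrable_featureForm (μ := μ) hlam hφm hφ hπ.measurable_action
    hπ.measurable_reward t
  have eVY := integral_comp_eq_of_map_eq hp2 hHY m2 hV
  have eVX := integral_comp_eq_of_map_eq hp3 hHX m3 hV
  have eS1 := integral_comp_eq_of_map_eq hp1 hHY m1 hS
  have eS2 := integral_comp_eq_of_map_eq hp2 hHY m2 hS
  have eF := integral_comp_eq_of_map_eq hp3 hHX m3 hF
  have iVY := integrable_comp_of_map_eq hp2 hHY m2 hV
    (integrable_glm_optimal hg.continuous hφm hπ hR hopt hps t)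
  have iVX := integrable_comp_of_map_eq hp3 hHX m3 hV (integrable_glm_action hπ t)
  have iS1 := integrable_comp_of_map_eq hp1 hHY m1 hS hSi
  have iS2 := integrable_comp_of_map_eq hp2 hHY m2 hS hSi
  have iF := integrable_comp_of_map_eq hp3 hHX m3 hF hFi
  -- `G` collects what `glm_sub_le` needs almost surely, in measurable form: the initial design was
  -- played, and parameter and feature lie in the closures.
  let G : Set ((Fin t → 𝒜 × ℝ) × E × E) := {p | (∀ i : Fin d, φ (p.1 (Fin.castLE ht i)).1 = φ (a i))
    ∧ p.2.1 ∈ closure (convexHull ℝ Θ) ∧ p.2.2 ∈ closure (Set.range φ)}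
  have hG : MeasurableSet G := by
    refine MeasurableSet.inter ?_ (MeasurableSet.inter ?_ ?_)
    · change MeasurableSet {p : (Fin t → 𝒜 × ℝ) × E × E |
        ∀ i : Fin d, φ (p.1 (Fin.castLE ht i)).1 = φ (a i)}
      rw [Set.ofPred_forall]
      refine MeasurableSet.iInter fun i => ?_
      have hm : Measurable fun p : (Fin t → 𝒜 × ℝ) × E × E => φ (p.1 (Fin.castLE ht i)).1 :=
        hφm.comp (by fun_prop)
      exact hm (measurableSet_singleton _)
    · exact (isClosed_closure.measurableSet).preimage (by fun_prop)
    · exact (isClosed_closure.measurableSet).preimage (by fun_prop)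
  have hGY : ∀ᵐ p ∂(μ.map fun ω => (history A R t ω, θ ω, φ (Aopt t ω))), p ∈ G := by
    refine (ae_map_iff hHY.aemeasurable hG).2 ?_
    filter_upwards [feature_initial_action hφm hπ hps, hθ] with ω h1 h2
    exact ⟨h1, subset_closure (subset_convexHull ℝ Θ h2),
      subset_closure (Set.mem_range_self _)⟩
  have hG1 : ∀ᵐ q ∂Ψ, p1 q ∈ G := ae_of_ae_map hp1.aemeasurable (m1 ▸ hGY)
  have hG2 : ∀ᵐ q ∂Ψ, p2 q ∈ G := ae_of_ae_map hp2.aemeasurable (m2 ▸ hGY)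
  have hle : ∀ᵐ q ∂Ψ, V (p2 q) - V (p3 q) ≤ slopeRatio g φ Θ * (η / 2 * F (p3 q)
      + 4 / η * (S (p1 q) + S (p2 q))) := by
    filter_upwards [hG1, hG2] with q h1 h2
    refine glm_sub_le hg hΘ hφ hl hlam ?_ h1.2.1 h2.2.1 h2.2.2 hη
    exact lam_mul_le_of_design _ hdesign ht (fun k => (φ (q.1 k).1).ofLp)
      fun i => congrArg WithLp.ofLp (h1.1 i)
  have iS : Integrable (fun q => S (p1 q) + S (p2 q)) Ψ := iS1.add iS2
  have iR : Integrable (fun q => slopeRatio g φ Θ * (η / 2 * F (p3 q)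
      + 4 / η * (S (p1 q) + S (p2 q)))) Ψ :=
    ((iF.const_mul _).add (iS.const_mul _)).const_mul _
  calc (∫ ω, glm g φ (θ ω) (Aopt t ω) ∂μ) - ∫ ω, glm g φ (θ ω) (A t ω) ∂μ
      = ∫ q, (V (p2 q) - V (p3 q)) ∂Ψ := by
        rw [integral_sub iVY iVX, eVY, eVX]
        rfl
    _ ≤ ∫ q, slopeRatio g φ Θ * (η / 2 * F (p3 q) + 4 / η * (S (p1 q) + S (p2 q))) ∂Ψ :=
        integral_mono_ae (iVY.sub iVX) iR hle
    _ = slopeRatio g φ Θ * (η / 2 * ∫ ω, featureForm lam φ (history A R t ω) (φ (A t ω)) ∂μ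
        + 8 / η * ∫ ω, scoreForm lam g φ (history A R t ω) (θ ω) ∂μ) := by
        rw [integral_const_mul, integral_add (iF.const_mul _) (iS.const_mul _),
          integral_const_mul, integral_const_mul, integral_add iS1 iS2, eF, eS1, eS2]
        simp only [F, S]
        ring

end Bandit

/-! ### Summation over the periods and constants. -/

lemma one_le_slopeRatio {d : ℕ} {𝒜 : Type*} {g : ℝ → ℝ} {φ : 𝒜 → EuclideanSpace ℝ (Fin d)}
    {Θ : Set (EuclideanSpace ℝ (Fin d))} (hl : 0 < sInf (slopes g φ Θ))
    (hb : BddAbove (slopes g φ Θ)) : 1 ≤ slopeRatio g φ Θ := by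
  have hne : (slopes g φ Θ).Nonempty := by
    by_contra h
    rw [Set.not_nonempty_iff_eq_empty.1 h, Real.sInf_empty] at hl
    exact lt_irrefl _ hl
  rw [slopeRatio, one_le_div hl]
  exact csInf_le_csSup hne (bddBelow_slopes hl) hb

/-- Since `1 + T M ≤ T (1 + M)`, the logarithm splits, and `log T ≥ log 2` absorbs the constant
part. -/
lemma log_one_add_mul_le {M : ℝ} (hM : 0 ≤ M) {T : ℕ} (hT : 2 ≤ T) :
    Real.log (1 + T * M) ≤ (1 + Real.log (1 + M) / Real.log 2) * Real.log T := by
  have hT' : (2 : ℝ) ≤ T := by exact_mod_cast hT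
  have h2 : 0 < Real.log 2 := Real.log_pos one_lt_two
  have hlog : Real.log 2 ≤ Real.log T := Real.log_le_log two_pos hT'
  have hM' : 0 ≤ Real.log (1 + M) := Real.log_nonneg (by linarith)
  calc Real.log (1 + T * M) ≤ Real.log (T * (1 + M)) :=
        Real.log_le_log (by positivity) (by nlinarith)
    _ = Real.log T + Real.log (1 + M) / Real.log 2 * Real.log 2 := by
        rw [Real.log_mul (by positivity) (by positivity)]
        field_simp
    _ ≤ Real.log T + Real.log (1 + M) / Real.log 2 * Real.log T := by gcongr
    _ = _ := by ring

lemma log_mul_sqrt_le {T : ℕ} (hT : 2 ≤ T) :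
    Real.log T * Real.sqrt (Real.log 2) ≤ Real.log T ^ (3 / 2 : ℝ) := by
  have hT' : (2 : ℝ) ≤ T := by exact_mod_cast hT
  have hlog : Real.log 2 ≤ Real.log T := Real.log_le_log two_pos hT'
  have hpos : 0 < Real.log T := (Real.log_pos one_lt_two).trans_le hlog
  have h : Real.log T ^ (3 / 2 : ℝ) = Real.log T * Real.sqrt (Real.log T) := by
    rw [Real.sqrt_eq_rpow, show (3 / 2 : ℝ) = 1 + 1 / 2 by norm_num, Real.rpow_add hpos,
      Real.rpow_one]
  rw [h]
  gcongr

section Bandit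

variable {d : ℕ} {𝒜 Ω : Type*} [MeasurableSpace 𝒜] [MeasurableSpace Ω] {lam c₁ c₂ C : ℝ}
  {g : ℝ → ℝ} {φ : 𝒜 → EuclideanSpace ℝ (Fin d)} {μ : Measure Ω} [IsProbabilityMeasure μ]
  {Θ : Set (EuclideanSpace ℝ (Fin d))}
  {θ : Ω → EuclideanSpace ℝ (Fin d)} {A Aopt : ℕ → Ω → 𝒜} {R : ℕ → Ω → ℝ} {π : Policy 𝒜}
  {a : Fin d → 𝒜}

lemma integral_scoreForm_le (hlam : 0 < lam) (hg : Measurable g)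
    (hφm : Measurable φ) (hφ : ∀ b, ‖φ b‖ ≤ c₂) (hπ : IsBanditProcess μ (glm g φ) π θ A R)
    (hR : ∀ t, ∀ᵐ ω ∂μ, R t ω ∈ Set.Icc 0 C) {t T : ℕ} (htT : t ≤ T) :
    ∫ ω, scoreForm lam g φ (history A R t ω) (θ ω) ∂μ
      ≤ C ^ 2 * ((1 + c₂ ^ 2 / lam) * (d * Real.log (1 + T * (c₂ ^ 2 / lam)))) := by
  refine (integral_scoreForm_le_sum hlam hg hφm hφ hπ hR t).trans ?_
  refine mul_le_mul_of_nonneg_left (le_trans ?_ (sum_integral_featureForm_le (μ := μ) hlam hφm hφ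
    hπ.measurable_action hπ.measurable_reward T)) (sq_nonneg _)
  exact Finset.sum_le_sum_of_subset_of_nonneg (by simpa using htT)
    fun k _ _ => integral_nonneg fun ω => featureForm_nonneg hlam _ _

lemma bayesRegret_le (hC : 0 < C) (hg : ContDiff ℝ 1 g) (hφm : Measurable φ)
    (hΘ : ∀ ρ ∈ Θ, ‖ρ‖ ≤ c₁) (hφ : ∀ b, ‖φ b‖ ≤ c₂) (hl : 0 < sInf (slopes g φ Θ))
    (hlam : 0 < lam)
    (hdesign : (∑ i, Matrix.vecMulVec (φ (a i)).ofLp (φ (a i)).ofLp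
      - lam • (1 : Matrix (Fin d) (Fin d) ℝ)).PosSemidef)
    (hθ : ∀ᵐ ω ∂μ, θ ω ∈ Θ)
    (hπ : IsBanditProcess μ (glm g φ) π θ A R) (hR : ∀ t, ∀ᵐ ω ∂μ, R t ω ∈ Set.Icc 0 C)
    (hopt : IsOptimalAction μ (glm g φ) θ Aopt)
    (hps : IsInitializedPosteriorSampling μ A R Aopt a π) {T : ℕ} (hT : 0 < T) :
    bayesRegret μ (glm g φ) θ A T ≤ C * d + slopeRatio g φ Θ * ((1 / 2 + 8 * C ^ 2)
      * ((1 + c₂ ^ 2 / lam) * (d * Real.log (1 + T * (c₂ ^ 2 / lam)))) * Real.sqrt T) := by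
  have hr : 0 ≤ slopeRatio g φ Θ :=
    zero_le_one.trans (one_le_slopeRatio hl (bddAbove_slopes hg hΘ hφ))
  set B := (1 + c₂ ^ 2 / lam) * (d * Real.log (1 + T * (c₂ ^ 2 / lam))) with hBdef
  have hM : 0 ≤ c₂ ^ 2 / lam := by positivity
  have hB : 0 ≤ B := by
    have : 0 ≤ Real.log (1 + T * (c₂ ^ 2 / lam)) :=
      Real.log_nonneg (by linarith [mul_nonneg (Nat.cast_nonneg (α := ℝ) T) hM])
    positivity
  have hsq : 0 < Real.sqrt T := Real.sqrt_pos.2 (by exact_mod_cast hT)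
  set x : ℕ → ℝ := fun t => ∫ ω, featureForm lam φ (history A R t ω) (φ (A t ω)) ∂μ with hx
  have hx0 : ∀ t, 0 ≤ x t := fun t => integral_nonneg fun ω => featureForm_nonneg hlam _ _
  have hstep : ∀ t ∈ Finset.range T, ∫ ω, periodRegret (glm g φ) θ A t ω ∂μ
      ≤ (if t < d then C else 0)
        + slopeRatio g φ Θ * (Real.sqrt T / 2 * x t + 8 / Real.sqrt T * (C ^ 2 * B)) := by
    intro t ht
    split_ifs with htd
    · exact (integral_periodRegret_le_of_bounded hg.continuous hφm hπ hR hopt hps t).trans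
        (le_add_of_nonneg_right (by have := hx0 t; positivity))
    · rw [zero_add]
      -- The choice `η = √T` balances `η * ∑ x t` against `T / η` times the bound on the score.
      refine (integral_periodRegret_le hg hφm hΘ hφ hl hlam hdesign hθ hπ hR hopt hps
        (not_lt.1 htd) hsq).trans ?_
      gcongr
      exact integral_scoreForm_le hlam hg.continuous.measurable hφm hφ hπ hR
        (Finset.mem_range.1 ht).le
  have hinit : ∑ t ∈ Finset.range T, (if t < d then C else 0) ≤ C * d := by
    rw [← Finset.sum_filter, Finset.sum_const, nsmul_eq_mul, mul_comm]
    gcongr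
    calc _ ≤ (Finset.range d).card := Finset.card_le_card fun k hk => by
          simpa using (Finset.mem_filter.1 hk).2
      _ = d := Finset.card_range d
  have hsum : ∑ t ∈ Finset.range T, x t ≤ B := sum_integral_featureForm_le hlam hφm hφ
    hπ.measurable_action hπ.measurable_reward T
  calc bayesRegret μ (glm g φ) θ A T ≤ _ := Finset.sum_le_sum hstep
    _ = ∑ t ∈ Finset.range T, (if t < d then C else 0) + slopeRatio g φ Θ *
        (Real.sqrt T / 2 * ∑ t ∈ Finset.range T, x t
          + T * (8 / Real.sqrt T * (C ^ 2 * B))) := by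
        rw [Finset.sum_add_distrib, ← Finset.mul_sum, Finset.sum_add_distrib, ← Finset.mul_sum,
          Finset.sum_const, Finset.card_range, nsmul_eq_mul]
    _ ≤ C * d + slopeRatio g φ Θ * (Real.sqrt T / 2 * B
          + T * (8 / Real.sqrt T * (C ^ 2 * B))) := by gcongr
    _ = _ := by
        have hTsq : (T : ℝ) = Real.sqrt T * Real.sqrt T := (Real.mul_self_sqrt (by positivity)).symm
        congr 2
        nth_rewrite 2 [hTsq]
        field_simp

end Bandit

end PosteriorSampling

/-! ### The main theorem. -/

open PosteriorSampling

theorem mainTheorem10 (c₁ c₂ C lam : ℝ) (hc₁ : 0 < c₁) (hc₂ : 0 < c₂) (hC : 0 < C)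
    (hlam : 0 < lam) :
    ∃ K : ℝ, 0 < K ∧
      ∀ (d : ℕ) (Θ : Set (EuclideanSpace ℝ (Fin d)))
        (𝒜 : Type*) [MeasurableSpace 𝒜] (φ : 𝒜 → EuclideanSpace ℝ (Fin d)) (g : ℝ → ℝ)
        (a : Fin d → 𝒜)
        (Ω : Type*) [MeasurableSpace Ω] (μ : Measure Ω) [IsProbabilityMeasure μ]
        (θ : Ω → EuclideanSpace ℝ (Fin d)) (A Aopt : ℕ → Ω → 𝒜) (R : ℕ → Ω → ℝ) (π : Policy 𝒜),
        StrictMono g → ContDiff ℝ 1 g → Measurable φ →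
        (∀ ρ ∈ Θ, ‖ρ‖ ≤ c₁) → (∀ b, ‖φ b‖ ≤ c₂) →
        0 < sInf (slopes g φ Θ) →
        (∑ i, Matrix.vecMulVec (φ (a i)).ofLp (φ (a i)).ofLp
          - lam • (1 : Matrix (Fin d) (Fin d) ℝ)).PosSemidef →
        (∀ᵐ ω ∂μ, θ ω ∈ Θ) →
        IsBanditProcess μ (glm g φ) π θ A R →
        (∀ t, ∀ᵐ ω ∂μ, R t ω ∈ Set.Icc 0 C) →
        IsOptimalAction μ (glm g φ) θ Aopt →
        IsInitializedPosteriorSampling μ A R Aopt a π →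
        (∀ t, Integrable (periodRegret (glm g φ) θ A t) μ) ∧
        ∀ T : ℕ, 2 ≤ T →
          bayesRegret μ (glm g φ) θ A T
            ≤ K * (slopeRatio g φ Θ * d * Real.log T ^ (3 / 2 : ℝ) * Real.sqrt T) := by
  have hM : 0 < c₂ ^ 2 / lam := by positivity
  set M := c₂ ^ 2 / lam with hMdef
  have h2 : 0 < Real.log 2 := Real.log_pos one_lt_two
  have hs2 : 0 < Real.sqrt (Real.log 2) := Real.sqrt_pos.2 h2
  have hlM : 0 ≤ Real.log (1 + M) := Real.log_nonneg (by linarith)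
  -- The first summand pays for the initial periods, using `r ≥ 1`, `√T ≥ 1` and `log T ≥ log 2`;
  -- the second for the rest. The divisions by `√(log 2)` come from weakening `log T` to its power
  -- `3 / 2`.
  refine ⟨C / (Real.log 2 * Real.sqrt (Real.log 2)) + (1 / 2 + 8 * C ^ 2) * (1 + M)
    * (1 + Real.log (1 + M) / Real.log 2) / Real.sqrt (Real.log 2), by positivity, ?_⟩
  intro d Θ 𝒜 _ φ g a Ω _ μ _ θ A Aopt R π _ hg hφm hΘ hφ hl hdesign hθ hπ hR hopt hps
  refine ⟨fun t => ((integrable_glm_optimal hg.continuous hφm hπ hR hopt hps t).sub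
    (integrable_glm_action hπ t)).congr (periodRegret_ae_eq hopt t).symm, fun T hT => ?_⟩
  refine (bayesRegret_le hC hg hφm hΘ hφ hl hlam hdesign hθ hπ hR hopt hps (by omega)).trans ?_
  have hr := one_le_slopeRatio hl (bddAbove_slopes hg hΘ hφ)
  set r := slopeRatio g φ Θ
  have hT1 : (1 : ℝ) ≤ Real.sqrt T := Real.one_le_sqrt.2 (by exact_mod_cast (by omega : 1 ≤ T))
  have hlogT : Real.log 2 ≤ Real.log T := Real.log_le_log two_pos (by exact_mod_cast hT)
  have hΛ := log_mul_sqrt_le hT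
  set Λ := Real.log T ^ (3 / 2 : ℝ)
  have hΛ1 : Real.log T ≤ Λ / Real.sqrt (Real.log 2) := (le_div_iff₀ hs2).2 hΛ
  have hΛ2 : 1 ≤ Λ / (Real.log 2 * Real.sqrt (Real.log 2)) := by
    rw [le_div_iff₀ (by positivity), one_mul]
    exact (mul_le_mul_of_nonneg_right hlogT hs2.le).trans hΛ
  have hlog := log_one_add_mul_le hM.le hT
  have e1 : C * d ≤ C / (Real.log 2 * Real.sqrt (Real.log 2)) * (r * d * Λ * Real.sqrt T) := by
    calc C * d = C * (1 * d * 1 * 1) := by ring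
      _ ≤ C * (r * d * (Λ / (Real.log 2 * Real.sqrt (Real.log 2))) * Real.sqrt T) := by gcongr
      _ = _ := by ring
  have e2 : r * ((1 / 2 + 8 * C ^ 2) * ((1 + M) * (d * Real.log (1 + T * M))) * Real.sqrt T)
      ≤ (1 / 2 + 8 * C ^ 2) * (1 + M) * (1 + Real.log (1 + M) / Real.log 2)
        / Real.sqrt (Real.log 2) * (r * d * Λ * Real.sqrt T) := by
    calc _ ≤ r * ((1 / 2 + 8 * C ^ 2) * ((1 + M) * (d * ((1 + Real.log (1 + M) / Real.log 2)
          * (Λ / Real.sqrt (Real.log 2))))) * Real.sqrt T) := by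
          gcongr
          exact hlog.trans (by gcongr)
      _ = _ := by ring
  exact (add_le_add e1 e2).trans (add_mul _ _ _).ge
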